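/- **Model.** Let $M\ge 0$ and $0<B_L\le B_U<\infty$, and let $g:[0,\infty)\to[0,\infty)$ be continuous and nondecreasing (the age penalty). Let $Y_0,Y_1,\dots$ be i.i.d. random transmission delays with $\Pr(Y_j\in[B_L,B_U])=1$, let $0<Q_1<Q_2<\cdots$ be the arrival times (queries) of a Poisson process of rate $\lambda>0$ on $(0,\infty)$, and let $W$ be an auxiliary random element (a source of randomization, possibly trivial); the delays, the queries and $W$ are independent of each other. An update policy is a sequence $\pi=(Z_0,Z_1,\dots)$ of waiting periods $Z_j\in[0,M]$. It determines delivery times $D_0=0$, $D_{j+1}=D_j+Z_j+Y_{j+1}$, request times $R_j=D_j-Y_j$ (so $R_{j+1}=D_j+Z_j$), and the age of information $\Delta(t)=t-\max\{R_j: D_j\le t\}$ for $t\ge 0$. The policy is causal if, for every $j$, $Z_j$ is a measurable function of $W$, $(Y_0,\dots,Y_j)$, $(Z_0,\dots,Z_{j-1})$ and the query times before $D_j$. Let $\Pi$ be the set of causal policies. The Update-or-Wait (UoW) problem is to minimize over $\pi\in\Pi$ the time average age penalty $$\bar g(\pi)=\limsup_{n\to\infty}\frac{E\big[\int_0^{D_n}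 g(\Delta(t))\,dt\big]}{E[D_n]},$$ and the Pull-or-Wait (PoW) problem is to minimize over $\pi\in\Pi$ the query average age penalty $$\bar h(\pi)=\limsup_{n\to\infty}\frac{E\big[\sum_{k=1}^n g(\Delta(Q_k))\big]}{n}.$$ **Proposition.** A policy $\pi\in\Pi$ is optimal for the UoW problem (it minimizes $\bar g$ over $\Pi$) if and only if it is optimal for the PoW problem (it minimizes $\bar h$ over $\Pi$). Moreover, both minima are attained and they are equal: $\min_{\pi\in\Pi}\bar g(\pi)=\min_{\pi\in\Pi}\bar h(\pi)$. -/

import Mathlib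

open MeasureTheory ProbabilityTheory Filter

noncomputable section

namespace PullOrWait

variable {Ω 𝓦 : Type*}

/-- Delivery times. `Y j` is the transmission delay of update `j`, `Z j` the waiting period after
the delivery of update `j`. Update `0` is delivered at the time origin, update `j + 1` is requested
at `D j + Z j` and delivered `Y (j + 1)` later. -/
def delivery (Y Z : ℕ → Ω → ℝ) : ℕ → Ω → ℝ
  | 0, _ => 0
  | j + 1, ω => delivery Y Z j ω + Z j ω + Y (j + 1) ω

/-- Request (generation) time `R j` of update `j`, so that `D j = R j + Y j`. -/
def request (Y Z : ℕ → Ω → ℝ) (j : ℕ) (ω : Ω) : ℝ :=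
  delivery Y Z j ω - Y j ω

/-- Age of information `Δ(t) = t - U(t)`, where `U(t) = max {R j : D j ≤ t}` is the generation time
of the most recent update received by time `t`. The delays are almost surely bounded below by a
positive constant, so for `t ≥ 0` the set is almost surely finite and contains `R 0`. -/
def age (Y Z : ℕ → Ω → ℝ) (ω : Ω) (t : ℝ) : ℝ :=
  t - sSup {x : ℝ | ∃ j : ℕ, delivery Y Z j ω ≤ t ∧ x = request Y Z j ω}

/-- What is known at the delivery time `D j`: the outcome of the randomization device `W`, the
delays `Y 0, …, Y j`, the earlier waiting periods `Z 0, …, Z (j - 1)`, and the queries before `D j`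
(the truncated times `min (Q k) (D j)` tell exactly which queries occurred before `D j`,
and when). -/
def history (W : Ω → 𝓦) (Y Q Z : ℕ → Ω → ℝ) (j : ℕ) (ω : Ω) :
    𝓦 × (Fin (j + 1) → ℝ) × (Fin j → ℝ) × (ℕ → ℝ) :=
  (W ω, fun i => Y i ω, fun i => Z i ω, fun k => min (Q k ω) (delivery Y Z j ω))

/-- The causal update policies `(Z 0, Z 1, …)`: each `Z j` takes values in `[0, M]` and is a
measurable function of the history at the delivery time of update `j`. -/
def causalPolicies [MeasurableSpace 𝓦] (W : Ω → 𝓦) (Y Q : ℕ → Ω → ℝ) (M : ℝ) :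
    Set (ℕ → Ω → ℝ) :=
  {Z | ∀ j, (∀ ω, Z j ω ∈ Set.Icc 0 M) ∧
    Measurable[MeasurableSpace.comap (history W Y Q Z j) inferInstance] (Z j)}

/-- The objective of the Update-or-Wait problem:
`limsup E[∫₀^{D n} g(Δ(t)) dt] / E[D n]`. -/
def timeAveragePenalty [MeasurableSpace Ω] (μ : Measure Ω) (g : ℝ → ℝ) (Y Z : ℕ → Ω → ℝ) : ℝ :=
  limsup (fun n : ℕ =>
    (∫ ω, (∫ t in (0 : ℝ)..delivery Y Z n ω, g (age Y Z ω t)) ∂μ) /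
      ∫ ω, delivery Y Z n ω ∂μ) atTop

/-- The objective of the Pull-or-Wait problem:
`limsup E[g(Δ(Q 1)) + ⋯ + g(Δ(Q n))] / n`. -/
def queryAveragePenalty [MeasurableSpace Ω] (μ : Measure Ω) (g : ℝ → ℝ) (Y Q Z : ℕ → Ω → ℝ) : ℝ :=
  limsup (fun n : ℕ =>
    (∫ ω, (∑ k ∈ Finset.Icc 1 n, g (age Y Z ω (Q k ω))) ∂μ) / (n : ℝ)) atTop

/-- `Q 1, Q 2, …` are the arrival times of a Poisson process of intensity `r` on `(0, ∞)`: the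
interarrival times are independent and exponential of rate `r`. Here `Q 0 = 0` is the time origin,
not an arrival. -/
structure IsPoissonArrivals [MeasurableSpace Ω] (μ : Measure Ω) (r : ℝ) (Q : ℕ → Ω → ℝ) :
    Prop where
  rate_pos : 0 < r
  measurable : ∀ k, Measurable (Q k)
  origin : ∀ ω, Q 0 ω = 0
  gap_indep : iIndepFun (fun k ω => Q (k + 1) ω - Q k ω) μ
  gap_law : ∀ k, HasLaw (fun ω => Q (k + 1) ω - Q k ω) (expMeasure r) μ

end PullOrWait

end

/-! Cut time at the deliveries. If update `j` is delivered with age `y` and the next request waits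
`z`, the cycle collects the integral of `g` from `y` to `y + z + Y (j + 1)`. Charging a price `v`
per unit of time, the mean excess of a cycle is `H (y + z) - G y - v * (z + m)`, where `G` is a
primitive of `g`, `H s` is the mean of `G (s + Y)` and `m` is the mean delay. Since `g` is
nondecreasing, `G` and `H` are convex, so for every `y` the best wait is the projection of one fixed
target age `x`: a threshold rule. `exists_optimal_threshold` chooses `v` as the least ratio of mean
penalty to mean length over threshold rules, which makes the optimal excess of a cycle have mean
zero.

Let `cumulativeLoss`, written `L n` here, be the expected shortfall from the threshold rule over `n`
cycles; its terms are nonnegative. For deliveries, `integral_delivery_eq` says that the mean penalty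
up to `D n` is exactly `L n + v * E[D n]`, and `E[D n]` is of order `n`. Hence the time average is
at least `v`, with equality if and only if `L n / n → 0`.

For queries, up to the next query the age is a function of data independent of the current
exponential gap, so Poisson arrivals see time averages: the mean query sum is `r` times the mean
penalty over `[0, Q n]` (`integral_sum_age_query`). Cycles stopped at `Q n` are weighted by the
event `D j ≤ Q n`, which is independent of `Y (j + 1)`. Up to bounded errors from the last cycle and
from deviations of `Q n`, the excess penalty over `[0, Q n]` therefore lies between two values of
`L` at indices proportional to `n` (`exists_bounds_integral_query`). So the query average is also at
least `v`, with equality if and only if `L n / n → 0`: the same criterion. The threshold rule has `L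
= 0` and attains both minima.

The hypotheses hold only almost surely, on the half line, and for policies given as functions on the
sample space. `exists_regularSystem` replaces the data by an almost surely equal copy in which all
bounds hold everywhere and the policy is a sequence of decision rules that can be rerun with later
queries hidden. -/

namespace PullOrWait

/-! ### Threshold rules and the one-cycle optimality equation -/

/-- The waiting period of the threshold policy: wait until the age reaches `x`, truncated to
`[0, M]`. -/
noncomputable def thresholdWait (M x y : ℝ) : ℝ := max 0 (min M (x - y))

/-- The penalty, in excess of `v` per unit of time, collected between two deliveries: the age grows
from `y` to `y + z + d`. -/
noncomputable def cyclePenalty (g : ℝ → ℝ) (v y z d : ℝ) : ℝ :=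
  (∫ t in y..(y + z + d), g t) - v * (z + d)

/-- The expected value of `cyclePenalty` when the delay `d` has law `ν`. -/
noncomputable def meanCyclePenalty (ν : Measure ℝ) (g : ℝ → ℝ) (v y z : ℝ) : ℝ :=
  ∫ d, cyclePenalty g v y z d ∂ν

lemma thresholdWait_mem {M : ℝ} (hM : 0 ≤ M) (x y : ℝ) : thresholdWait M x y ∈ Set.Icc 0 M :=
  ⟨le_max_left _ _, max_le hM (min_le_left _ _)⟩

lemma continuous_thresholdWait (M : ℝ) :
    Continuous (fun p : ℝ × ℝ => thresholdWait M p.1 p.2) := by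
  unfold thresholdWait; fun_prop

lemma integrable_of_continuous_of_mem_Icc {ν : Measure ℝ} [IsFiniteMeasure ν] {a b : ℝ}
    (hν : ∀ᵐ y ∂ν, y ∈ Set.Icc a b) {f : ℝ → ℝ} (hf : Continuous f) : Integrable f ν := by
  obtain ⟨C, hC⟩ := isCompact_Icc.exists_bound_of_continuousOn (hf.continuousOn (s := Set.Icc a b))
  exact Integrable.of_bound hf.aestronglyMeasurable C (hν.mono fun y hy => hC y hy)

lemma convexOn_primitive {g : ℝ → ℝ} (hg : Continuous g) (hmono : Monotone g) :
    ConvexOn ℝ Set.univ (fun x => ∫ t in (0 : ℝ)..x, g t) := by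
  have hd : ∀ x, HasDerivAt (fun x => ∫ t in (0 : ℝ)..x, g t) (g x) x := fun x =>
    intervalIntegral.integral_hasDerivAt_right (hg.intervalIntegrable _ _)
      (hg.stronglyMeasurableAtFilter _ _) hg.continuousAt
  refine MonotoneOn.convexOn_of_deriv convex_univ ?_ ?_ ?_
  · exact fun x _ => (hd x).continuousAt.continuousWithinAt
  · exact fun x _ => (hd x).differentiableAt.differentiableWithinAt
  · intro x _ y _ hxy
    rw [(hd x).deriv, (hd y).deriv]
    exact hmono hxy

lemma convexOn_integral_translate {ν : Measure ℝ} [IsProbabilityMeasure ν] {G : ℝ → ℝ}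
    (hG : ConvexOn ℝ Set.univ G) (h_int : ∀ x, Integrable (fun y => G (x + y)) ν) :
    ConvexOn ℝ Set.univ (fun x => ∫ y, G (x + y) ∂ν) := by
  refine ⟨convex_univ, fun x _ x' _ a b ha hb hab => ?_⟩
  simp only [smul_eq_mul]
  rw [← integral_const_mul, ← integral_const_mul, ← integral_add ((h_int _).const_mul _)
    ((h_int _).const_mul _)]
  refine integral_mono (h_int _) (((h_int _).const_mul _).add ((h_int _).const_mul _)) fun y => ?_
  have := hG.2 (Set.mem_univ (x + y)) (Set.mem_univ (x' + y)) ha hb hab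
  simp only [smul_eq_mul] at this
  have e : a * x + b * x' + y = a * (x + y) + b * (x' + y) := by
    linear_combination (-y) * hab
  simpa only [e] using this

/-- A convex function is minimized on `[y, y + M]` at the projection of a global minimizer. -/
lemma convexOn_projection_le {H : ℝ → ℝ} (hH : ConvexOn ℝ Set.univ H) {M x y z : ℝ}
    (hz : z ∈ Set.Icc 0 M) (hx : H x ≤ H (y + z)) :
    H (y + thresholdWait M x y) ≤ H (y + z) := by
  obtain ⟨hz0, hzM⟩ := hz
  unfold thresholdWait
  rcases le_total x y with h | h
  · have h1 : max 0 (min M (x - y)) = 0 :=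
      max_eq_left ((min_le_right _ _).trans (by linarith))
    rw [h1, add_zero]
    have := hH.le_max_of_mem_Icc (Set.mem_univ x) (Set.mem_univ (y + z)) (z := y)
      ⟨h, by linarith⟩
    exact this.trans (max_le hx le_rfl)
  · rw [max_eq_right (le_min (hz0.trans hzM) (by linarith))]
    rcases le_total M (x - y) with h2 | h2
    · rw [min_eq_left h2]
      have := hH.le_max_of_mem_Icc (Set.mem_univ (y + z)) (Set.mem_univ x) (z := y + M)
        ⟨by linarith, by linarith⟩
      exact this.trans (max_le le_rfl hx)
    · rw [min_eq_right h2]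
      simpa using hx

lemma meanCyclePenalty_eq {ν : Measure ℝ} [IsProbabilityMeasure ν] {a b : ℝ}
    (hν : ∀ᵐ y ∂ν, y ∈ Set.Icc a b) {g : ℝ → ℝ} (hg : Continuous g) (v y z : ℝ) :
    meanCyclePenalty ν g v y z = (∫ y', (∫ t in (0 : ℝ)..(y + z + y'), g t) ∂ν)
      - (∫ t in (0 : ℝ)..y, g t) - v * (z + ∫ y', y' ∂ν) := by
  have hc : Continuous (fun x => ∫ t in (0 : ℝ)..x, g t) :=
    intervalIntegral.continuous_primitive (fun _ _ => hg.intervalIntegrable _ _) 0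
  have h1 : Integrable (fun y' => ∫ t in (0 : ℝ)..(y + z + y'), g t) ν :=
    integrable_of_continuous_of_mem_Icc hν (hc.comp (continuous_const.add continuous_id))
  have h2 : Integrable (fun y' : ℝ => v * (z + y')) ν :=
    integrable_of_continuous_of_mem_Icc hν (by fun_prop)
  have h3 : Integrable (fun y' : ℝ => y') ν :=
    integrable_of_continuous_of_mem_Icc hν (by fun_prop)
  unfold meanCyclePenalty cyclePenalty
  have e : ∀ y', (∫ t in y..(y + z + y'), g t)
      = (∫ t in (0 : ℝ)..(y + z + y'), g t) - ∫ t in (0 : ℝ)..y, g t := fun y' =>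
    (intervalIntegral.integral_interval_sub_left (hg.intervalIntegrable _ _)
      (hg.intervalIntegrable _ _)).symm
  simp_rw [e]
  rw [integral_sub (by exact h1.sub (integrable_const _)) h2, integral_sub h1 (integrable_const _),
    integral_const_mul, integral_add (integrable_const _) h3]
  simp

lemma continuous_cyclePenalty {g : ℝ → ℝ} (hg : Continuous g) (v : ℝ) :
    Continuous fun p : ℝ × ℝ × ℝ => cyclePenalty g v p.1 p.2.1 p.2.2 := by
  have hc : Continuous (fun x => ∫ t in (0 : ℝ)..x, g t) :=
    intervalIntegral.continuous_primitive (fun _ _ => hg.intervalIntegrable _ _) 0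
  have e : (fun p : ℝ × ℝ × ℝ => cyclePenalty g v p.1 p.2.1 p.2.2) = fun p =>
      (∫ t in (0 : ℝ)..(p.1 + p.2.1 + p.2.2), g t) - (∫ t in (0 : ℝ)..p.1, g t)
        - v * (p.2.1 + p.2.2) := funext fun p => by
    rw [cyclePenalty, intervalIntegral.integral_interval_sub_left (hg.intervalIntegrable _ _)
      (hg.intervalIntegrable _ _)]
  rw [e]
  refine ((hc.comp ?_).sub (hc.comp continuous_fst)).sub ?_ <;> fun_prop

lemma continuous_meanCyclePenalty {ν : Measure ℝ} [IsProbabilityMeasure ν] {a b : ℝ}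
    (hν : ∀ᵐ y ∂ν, y ∈ Set.Icc a b) {g : ℝ → ℝ} (hg : Continuous g) (hmono : Monotone g) (v : ℝ) :
    Continuous fun p : ℝ × ℝ => meanCyclePenalty ν g v p.1 p.2 := by
  have hc : Continuous (fun x => ∫ t in (0 : ℝ)..x, g t) :=
    intervalIntegral.continuous_primitive (fun _ _ => hg.intervalIntegrable _ _) 0
  -- A finite convex function on the line is continuous, so no domination argument is needed.
  have hH : Continuous fun x => ∫ y', (∫ t in (0 : ℝ)..(x + y'), g t) ∂ν :=
    continuousOn_univ.mp ((convexOn_integral_translate (convexOn_primitive hg hmono) fun x =>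
      integrable_of_continuous_of_mem_Icc hν
        (hc.comp (continuous_const.add continuous_id))).continuousOn isOpen_univ)
  simp_rw [meanCyclePenalty_eq hν hg]
  refine ((hH.comp ?_).sub (hc.comp continuous_fst)).sub ?_ <;> fun_prop

/-- There are a value `v` and a threshold `x` such that waiting until the age reaches `x` minimizes
the mean excess penalty of a cycle for every initial age, and the minimum has mean zero. -/
theorem exists_optimal_threshold {ν : Measure ℝ} [IsProbabilityMeasure ν] {a b M : ℝ} (ha : 0 < a)
    (hM : 0 ≤ M) (hν : ∀ᵐ y ∂ν, y ∈ Set.Icc a b) {g : ℝ → ℝ} (hg : Continuous g)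
    (hmono : Monotone g) :
    ∃ v x : ℝ, (∀ y ∈ Set.Icc a b, ∀ z ∈ Set.Icc 0 M,
        meanCyclePenalty ν g v y (thresholdWait M x y) ≤ meanCyclePenalty ν g v y z) ∧
      ∫ y, meanCyclePenalty ν g v y (thresholdWait M x y) ∂ν = 0 := by
  set G : ℝ → ℝ := fun x => ∫ t in (0 : ℝ)..x, g t with hGdef
  have hGc : Continuous G :=
    intervalIntegral.continuous_primitive (fun _ _ => hg.intervalIntegrable _ _) 0
  have hGint : ∀ x, Integrable (fun y => G (x + y)) ν := fun x =>
    integrable_of_continuous_of_mem_Icc hν (hGc.comp (continuous_const.add continuous_id))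
  set H : ℝ → ℝ := fun x => ∫ y, G (x + y) ∂ν with hHdef
  have hHconv : ConvexOn ℝ Set.univ H :=
    convexOn_integral_translate (convexOn_primitive hg hmono) hGint
  have hHc : Continuous H := continuousOn_univ.mp (hHconv.continuousOn isOpen_univ)
  set m := ∫ y, y ∂ν with hm
  have hΦ : ∀ v y z, meanCyclePenalty ν g v y z = H (y + z) - G y - v * (z + m) :=
    fun v y z => meanCyclePenalty_eq hν hg v y z
  have hidint : Integrable (fun y : ℝ => y) ν :=
    integrable_of_continuous_of_mem_Icc hν continuous_id
  have ham : a ≤ m := by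
    have : ∫ _, a ∂ν ≤ m := integral_mono_ae (integrable_const _) hidint (hν.mono fun y hy => hy.1)
    simpa using this
  have hab : a ≤ b := by
    obtain ⟨y, hy⟩ := hν.exists
    exact hy.1.trans hy.2
  have hw : Continuous (fun p : ℝ × ℝ => thresholdWait M p.1 p.2) := continuous_thresholdWait M
  have hwx : ∀ y, Continuous fun x => thresholdWait M x y := fun y =>
    hw.comp (continuous_id.prodMk continuous_const)
  have hwy : ∀ x, Continuous fun y => thresholdWait M x y := fun x =>
    hw.comp (continuous_const.prodMk continuous_id)
  set K := Set.Icc (0 : ℝ) (b + M) with hK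
  have hKc : IsCompact K := isCompact_Icc
  have hKne : K.Nonempty := ⟨0, le_rfl, by linarith⟩
  have hmemK : ∀ y ∈ Set.Icc a b, ∀ z ∈ Set.Icc (0 : ℝ) M, y + z ∈ K := fun y hy z hz =>
    ⟨by linarith [hy.1, hz.1], by linarith [hy.2, hz.2]⟩
  -- `A x` and `T x` are the mean penalty and the mean length of a cycle under the threshold `x`.
  set A : ℝ → ℝ := fun x => ∫ y, (H (y + thresholdWait M x y) - G y) ∂ν with hA
  set T : ℝ → ℝ := fun x => ∫ y, (thresholdWait M x y + m) ∂ν with hT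
  obtain ⟨C₁, hC₁⟩ := hKc.exists_bound_of_continuousOn hHc.continuousOn
  obtain ⟨C₂, hC₂⟩ := hKc.exists_bound_of_continuousOn hGc.continuousOn
  have hAc : Continuous A := by
    refine continuous_of_dominated (bound := fun _ => C₁ + C₂) ?_ ?_ (integrable_const _) ?_
    · intro x
      exact ((hHc.comp (continuous_id.add (hwy x))).sub hGc).aestronglyMeasurable
    · intro x
      filter_upwards [hν] with y hy
      refine (norm_sub_le _ _).trans (add_le_add (hC₁ _ (hmemK y hy _ (thresholdWait_mem hM x y)))
        (hC₂ _ ?_))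
      simpa using hmemK y hy 0 ⟨le_rfl, hM⟩
    · exact Eventually.of_forall fun y =>
        (hHc.comp (continuous_const.add (hwx y))).sub continuous_const
  have hTc : Continuous T := by
    refine continuous_of_dominated (bound := fun _ => M + m) ?_ ?_ (integrable_const _) ?_
    · exact fun x => ((hwy x).add continuous_const).aestronglyMeasurable
    · intro x
      refine Eventually.of_forall fun y => ?_
      have := thresholdWait_mem hM x y
      rw [Real.norm_eq_abs, abs_of_nonneg (by linarith [this.1])]
      linarith [this.2]
    · exact Eventually.of_forall fun y => (hwx y).add continuous_const
  have hTint : ∀ x, Integrable (fun y => thresholdWait M x y + m) ν := fun x =>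
    integrable_of_continuous_of_mem_Icc hν ((hwy x).add continuous_const)
  have hAint : ∀ x, Integrable (fun y => H (y + thresholdWait M x y) - G y) ν := fun x =>
    integrable_of_continuous_of_mem_Icc hν ((hHc.comp (continuous_id.add (hwy x))).sub hGc)
  have hTpos : ∀ x, 0 < T x := by
    intro x
    have : ∫ _, m ∂ν ≤ T x := integral_mono (integrable_const _) (hTint x) fun y => by
      have := (thresholdWait_mem hM x y).1
      simpa using this
    rw [integral_const] at this
    simp at this
    linarith
  -- Fractional programming: `v` is the least ratio `A / T`, attained at `x₀`. The threshold `x`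
  -- chosen below minimizes the linearized cost `H s - v * s` instead, and need not be `x₀`.
  obtain ⟨x₀, -, hx₀⟩ := hKc.exists_isMinOn hKne
    (hAc.div hTc fun x => (hTpos x).ne').continuousOn
  set v := A x₀ / T x₀ with hv
  have hHv : ConvexOn ℝ Set.univ (fun x => H x - v * x) := by
    refine ⟨convex_univ, fun x hx x' hx' c d hc hd hcd => ?_⟩
    have := hHconv.2 hx hx' hc hd hcd
    simp only [smul_eq_mul] at this ⊢
    linarith
  obtain ⟨x, hxK, hx⟩ := hKc.exists_isMinOn hKne
    (hHc.sub (continuous_const.mul continuous_id)).continuousOn (f := fun x => H x - v * x)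
  have hopt : ∀ y ∈ Set.Icc a b, ∀ z ∈ Set.Icc 0 M,
      meanCyclePenalty ν g v y (thresholdWait M x y) ≤ meanCyclePenalty ν g v y z := by
    intro y hy z hz
    have := convexOn_projection_le hHv hz (hx (hmemK y hy z hz))
    rw [hΦ, hΦ]
    linarith
  have h_int : ∀ x', ∫ y, meanCyclePenalty ν g v y (thresholdWait M x' y) ∂ν = A x' - v * T x' := by
    intro x'
    simp_rw [hΦ]
    rw [integral_sub (hAint x') ((hTint x').const_mul v), integral_const_mul]
  have hΦint : ∀ x', Integrable (fun y => meanCyclePenalty ν g v y (thresholdWait M x' y)) ν := by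
    intro x'
    simp_rw [hΦ]
    exact (hAint x').sub ((hTint x').const_mul v)
  refine ⟨v, x, hopt, le_antisymm ?_ ?_⟩
  -- The threshold `x₀` has mean excess exactly zero at price `v`, and `x` is at least as good for
  -- each initial age.
  · have h0 : ∫ y, meanCyclePenalty ν g v y (thresholdWait M x₀ y) ∂ν = 0 := by
      rw [h_int, hv, div_mul_cancel₀ _ (hTpos x₀).ne', sub_self]
    rw [← h0]
    exact integral_mono_ae (hΦint x) (hΦint x₀)
      (hν.mono fun y hy => hopt y hy _ (thresholdWait_mem hM x₀ y))
  -- Conversely `x` lies in `K`, so its own ratio is at least `v`.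
  · rw [h_int]
    have : v ≤ A x / T x := hx₀ hxK
    rw [le_div_iff₀ (hTpos x)] at this
    linarith

/-! ### Sample paths: deliveries, age and decomposition into cycles -/

section Paths

variable {Ω : Type*} {Y Z : ℕ → Ω → ℝ} {ω : Ω} {a b M : ℝ}

lemma delivery_succ (Y Z : ℕ → Ω → ℝ) (j : ℕ) (ω : Ω) :
    delivery Y Z (j + 1) ω = delivery Y Z j ω + Z j ω + Y (j + 1) ω := rfl

lemma delivery_add_le (hY : ∀ j, Y j ω ∈ Set.Icc a b) (hZ : ∀ j, Z j ω ∈ Set.Icc 0 M) (j : ℕ) :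
    delivery Y Z j ω + a ≤ delivery Y Z (j + 1) ω := by
  rw [delivery_succ]; linarith [(hY (j + 1)).1, (hZ j).1]

lemma delivery_le_add (hY : ∀ j, Y j ω ∈ Set.Icc a b) (hZ : ∀ j, Z j ω ∈ Set.Icc 0 M) (j : ℕ) :
    delivery Y Z (j + 1) ω ≤ delivery Y Z j ω + (M + b) := by
  rw [delivery_succ]; linarith [(hY (j + 1)).2, (hZ j).2]

lemma mul_le_delivery (hY : ∀ j, Y j ω ∈ Set.Icc a b) (hZ : ∀ j, Z j ω ∈ Set.Icc 0 M) (j : ℕ) :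
    j * a ≤ delivery Y Z j ω := by
  induction j with
  | zero => simp [delivery]
  | succ j ih => push_cast; linarith [delivery_add_le hY hZ j]

lemma delivery_le_mul (hY : ∀ j, Y j ω ∈ Set.Icc a b) (hZ : ∀ j, Z j ω ∈ Set.Icc 0 M) (j : ℕ) :
    delivery Y Z j ω ≤ j * (M + b) := by
  induction j with
  | zero => simp [delivery]
  | succ j ih => push_cast; linarith [delivery_le_add hY hZ j]

lemma strictMono_delivery (ha : 0 < a) (hY : ∀ j, Y j ω ∈ Set.Icc a b)
    (hZ : ∀ j, Z j ω ∈ Set.Icc 0 M) : StrictMono fun j => delivery Y Z j ω :=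
  strictMono_nat_of_lt_succ fun j => by linarith [delivery_add_le hY hZ j]

lemma delivery_nonneg (ha : 0 < a) (hY : ∀ j, Y j ω ∈ Set.Icc a b)
    (hZ : ∀ j, Z j ω ∈ Set.Icc 0 M) (j : ℕ) : 0 ≤ delivery Y Z j ω :=
  (by positivity : (0 : ℝ) ≤ j * a).trans (mul_le_delivery hY hZ j)

lemma exists_delivery_le_lt (ha : 0 < a) (hY : ∀ j, Y j ω ∈ Set.Icc a b)
    (hZ : ∀ j, Z j ω ∈ Set.Icc 0 M) {t : ℝ} (ht : 0 ≤ t) :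
    ∃ j, delivery Y Z j ω ≤ t ∧ t < delivery Y Z (j + 1) ω := by
  have hex : ∃ n, t < delivery Y Z n ω := by
    obtain ⟨n, hn⟩ := exists_nat_gt (t / a)
    exact ⟨n, ((div_lt_iff₀ ha).mp hn).trans_le (mul_le_delivery hY hZ n)⟩
  classical
  have hne : Nat.find hex ≠ 0 := by
    intro h0
    have := Nat.find_spec hex
    rw [h0] at this
    exact absurd this (not_lt.mpr ht)
  obtain ⟨j, hj⟩ := Nat.exists_eq_succ_of_ne_zero hne
  refine ⟨j, not_lt.mp (Nat.find_min hex (by omega)), ?_⟩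
  have := Nat.find_spec hex
  rwa [hj] at this

/-- Request times are nondecreasing, since an update is requested only after the previous delivery;
the last update delivered is therefore the freshest. -/
lemma age_eq (ha : 0 < a) (hY : ∀ j, Y j ω ∈ Set.Icc a b) (hZ : ∀ j, Z j ω ∈ Set.Icc 0 M)
    {j : ℕ} {t : ℝ} (h1 : delivery Y Z j ω ≤ t) (h2 : t < delivery Y Z (j + 1) ω) :
    age Y Z ω t = t - delivery Y Z j ω + Y j ω := by
  have hR : Monotone fun i => request Y Z i ω := monotone_nat_of_le_succ fun i => by
    simp only [request, delivery_succ]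
    linarith [(hY i).1, (hZ i).1]
  have : IsGreatest {x : ℝ | ∃ j : ℕ, delivery Y Z j ω ≤ t ∧ x = request Y Z j ω}
      (request Y Z j ω) := by
    refine ⟨⟨j, h1, rfl⟩, ?_⟩
    rintro x ⟨i, hi, rfl⟩
    refine hR (Nat.lt_succ_iff.mp ?_)
    exact (strictMono_delivery ha hY hZ).lt_iff_lt.mp (hi.trans_lt h2)
  rw [age, this.csSup_eq, request]
  ring

lemma age_mem (ha : 0 < a) (hY : ∀ j, Y j ω ∈ Set.Icc a b) (hZ : ∀ j, Z j ω ∈ Set.Icc 0 M)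
    {t : ℝ} (ht : 0 ≤ t) : age Y Z ω t ∈ Set.Icc 0 (M + 2 * b) := by
  obtain ⟨j, h1, h2⟩ := exists_delivery_le_lt ha hY hZ ht
  rw [age_eq ha hY hZ h1 h2]
  have := delivery_le_add hY hZ j
  constructor <;> linarith [(hY j).1, (hY j).2]

/-- Turns the set supremum into a countable supremum of measurable functions. The default `request Y
Z 0 ω` adds nothing new, because update `0` is already delivered when `t ≥ 0`. -/
lemma age_eq_sub_iSup (Y Z : ℕ → Ω → ℝ) (ω : Ω) {t : ℝ} (ht : 0 ≤ t) :
    age Y Z ω t = t - ⨆ j, if delivery Y Z j ω ≤ t then request Y Z j ω else request Y Z 0 ω := by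
  rw [age, iSup]
  congr 2
  ext x
  constructor
  · rintro ⟨j, hj, rfl⟩
    exact ⟨j, if_pos hj⟩
  · rintro ⟨j, rfl⟩
    by_cases hj : delivery Y Z j ω ≤ t
    · exact ⟨j, hj, if_pos hj⟩
    · exact ⟨0, ht, if_neg hj⟩

lemma measurable_delivery [MeasurableSpace Ω] (hY : ∀ j, Measurable (Y j))
    (hZ : ∀ j, Measurable (Z j)) (j : ℕ) : Measurable (delivery Y Z j) := by
  induction j with
  | zero => exact measurable_const
  | succ j ih => exact (ih.add (hZ j)).add (hY (j + 1))

lemma measurable_age [MeasurableSpace Ω] (hY : ∀ j, Measurable (Y j))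
    (hZ : ∀ j, Measurable (Z j)) :
    Measurable fun p : Ω × ℝ => age Y Z p.1 (max p.2 0) := by
  have hD := measurable_delivery hY hZ
  have hR : ∀ j, Measurable (request Y Z j) := fun j => (hD j).sub (hY j)
  have ht : Measurable fun p : Ω × ℝ => max p.2 0 := by fun_prop
  have e : (fun p : Ω × ℝ => age Y Z p.1 (max p.2 0)) = fun p => max p.2 0 - ⨆ j,
      if delivery Y Z j p.1 ≤ max p.2 0 then request Y Z j p.1 else request Y Z 0 p.1 :=
    funext fun p => age_eq_sub_iSup Y Z p.1 (le_max_right _ _)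
  rw [e]
  refine ht.sub (Measurable.iSup fun j => Measurable.ite ?_ ?_ ?_)
  · exact measurableSet_le ((hD j).comp measurable_fst) ht
  · exact (hR j).comp measurable_fst
  · exact (hR 0).comp measurable_fst

/-- The penalty along a path is interval integrable. -/
lemma intervalIntegrable_age (ha : 0 < a) (hY : ∀ j, Y j ω ∈ Set.Icc a b)
    (hZ : ∀ j, Z j ω ∈ Set.Icc 0 M) {g : ℝ → ℝ} (hg : Continuous g) {s t : ℝ} (hs : 0 ≤ s)
    (ht : 0 ≤ t) : IntervalIntegrable (fun t => g (age Y Z ω t)) volume s t := by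
  obtain ⟨C, hC⟩ := isCompact_Icc.exists_bound_of_continuousOn
    (hg.continuousOn (s := Set.Icc 0 (M + 2 * b)))
  have hmeas : Measurable fun t => age Y Z ω (max t 0) := by
    -- Freezing `ω` and using a one-point sample space extracts measurability in time from joint
    -- measurability, without assuming that the delays are measurable.
    have := measurable_age (Ω := Unit) (Y := fun j _ => Y j ω) (Z := fun j _ => Z j ω)
      (fun _ => measurable_const) (fun _ => measurable_const)
    have e : ∀ j, delivery (fun j (_ : Unit) => Y j ω) (fun j _ => Z j ω) j ()
        = delivery Y Z j ω := by
      intro j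
      induction j with
      | zero => rfl
      | succ j ih => rw [delivery_succ, delivery_succ, ih]
    have e' : ∀ t, age (fun j (_ : Unit) => Y j ω) (fun j _ => Z j ω) () t = age Y Z ω t := by
      intro t
      simp only [age, request, e]
    have h2 := this.comp (measurable_prodMk_left (x := ()) (β := ℝ))
    simpa only [Function.comp_def, e'] using h2
  have hpos : ∀ u ∈ Set.uIoc s t, 0 ≤ u := by
    intro u hu
    rw [Set.uIoc, Set.mem_Ioc] at hu
    exact (le_min hs ht).trans hu.1.le
  have h_int : IntervalIntegrable (fun t => g (age Y Z ω (max t 0))) volume s t := by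
    rw [intervalIntegrable_iff]
    refine Measure.integrableOn_of_bounded (M := C) (by simp)
      (hg.measurable.comp hmeas).aestronglyMeasurable ?_
    exact Eventually.of_forall fun u => hC _ (age_mem ha hY hZ (le_max_right _ _))
  refine h_int.congr ?_
  intro u hu
  simp only [max_eq_left (hpos u hu)]

lemma integral_cycle (ha : 0 < a) (hY : ∀ j, Y j ω ∈ Set.Icc a b)
    (hZ : ∀ j, Z j ω ∈ Set.Icc 0 M) (g : ℝ → ℝ) (j : ℕ) :
    ∫ t in delivery Y Z j ω..delivery Y Z (j + 1) ω, g (age Y Z ω t)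
      = ∫ t in Y j ω..(Y j ω + Z j ω + Y (j + 1) ω), g t := by
  have hle : delivery Y Z j ω ≤ delivery Y Z (j + 1) ω :=
    ((strictMono_delivery ha hY hZ) (Nat.lt_succ_self j)).le
  have h1 : ∫ t in delivery Y Z j ω..delivery Y Z (j + 1) ω, g (age Y Z ω t)
      = ∫ t in delivery Y Z j ω..delivery Y Z (j + 1) ω, g (t + (Y j ω - delivery Y Z j ω)) := by
    -- The age jumps at the next delivery, so the right endpoint is discarded before substituting
    -- the formula.
    rw [intervalIntegral.integral_of_le hle, intervalIntegral.integral_of_le hle,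
      integral_Ioc_eq_integral_Ioo, integral_Ioc_eq_integral_Ioo]
    refine setIntegral_congr_fun measurableSet_Ioo fun t ht => ?_
    simp only [age_eq ha hY hZ ht.1.le ht.2]
    ring_nf
  rw [h1, intervalIntegral.integral_comp_add_right (fun t => g t)]
  congr 1
  · ring
  · rw [delivery_succ]; ring

lemma integral_cycle_sub (ha : 0 < a) (hY : ∀ j, Y j ω ∈ Set.Icc a b)
    (hZ : ∀ j, Z j ω ∈ Set.Icc 0 M) {g : ℝ → ℝ} (hg : Continuous g) (v : ℝ) (j : ℕ) :
    ∫ t in delivery Y Z j ω..delivery Y Z (j + 1) ω, (g (age Y Z ω t) - v)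
      = cyclePenalty g v (Y j ω) (Z j ω) (Y (j + 1) ω) := by
  have hD := delivery_nonneg ha hY hZ
  rw [intervalIntegral.integral_sub (intervalIntegrable_age ha hY hZ hg (hD _) (hD _))
    intervalIntegrable_const, integral_cycle ha hY hZ, intervalIntegral.integral_const,
    cyclePenalty, delivery_succ, smul_eq_mul]
  ring

lemma integral_delivery_sub (ha : 0 < a) (hY : ∀ j, Y j ω ∈ Set.Icc a b)
    (hZ : ∀ j, Z j ω ∈ Set.Icc 0 M) {g : ℝ → ℝ} (hg : Continuous g) (v : ℝ) (n : ℕ) :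
    ∫ t in (0 : ℝ)..delivery Y Z n ω, (g (age Y Z ω t) - v)
      = ∑ j ∈ Finset.range n, cyclePenalty g v (Y j ω) (Z j ω) (Y (j + 1) ω) := by
  have hD := delivery_nonneg ha hY hZ
  have hi : ∀ {s t : ℝ}, 0 ≤ s → 0 ≤ t →
      IntervalIntegrable (fun t => g (age Y Z ω t) - v) volume s t := fun hs ht =>
    (intervalIntegrable_age ha hY hZ hg hs ht).sub intervalIntegrable_const
  induction n with
  | zero => simp [delivery]
  | succ n ih =>
    rw [Finset.sum_range_succ, ← ih, ← integral_cycle_sub ha hY hZ hg,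
      intervalIntegral.integral_add_adjacent_intervals (hi le_rfl (hD _)) (hi (hD _) (hD _))]

/-- Up to the last cycle, the excess penalty collected before `T` is the sum of the excess penalties
of the cycles that start before `T`. -/
lemma abs_integral_min_sub_sum_le (ha : 0 < a) (hY : ∀ j, Y j ω ∈ Set.Icc a b)
    (hZ : ∀ j, Z j ω ∈ Set.Icc 0 M) {g : ℝ → ℝ} (hg : Continuous g) {v C T : ℝ} (hT : 0 ≤ T)
    (hC : ∀ x ∈ Set.Icc 0 (M + 2 * b), |g x - v| ≤ C) (n : ℕ) :
    |(∫ t in (0 : ℝ)..min T (delivery Y Z n ω), (g (age Y Z ω t) - v))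
      - ∑ j ∈ Finset.range n, (if delivery Y Z j ω ≤ T then
          cyclePenalty g v (Y j ω) (Z j ω) (Y (j + 1) ω) else 0)|
      ≤ if delivery Y Z n ω ≤ T then 0 else C * (M + b) := by
  have hD := delivery_nonneg ha hY hZ
  have hmono := strictMono_delivery ha hY hZ
  have hi : ∀ {s t : ℝ}, 0 ≤ s → 0 ≤ t →
      IntervalIntegrable (fun t => g (age Y Z ω t) - v) volume s t := fun hs ht =>
    (intervalIntegrable_age ha hY hZ hg hs ht).sub intervalIntegrable_const
  induction n with
  | zero => simp [delivery, hT]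
  | succ n ih =>
    have hlt : delivery Y Z n ω < delivery Y Z (n + 1) ω := hmono (Nat.lt_succ_self n)
    rw [Finset.sum_range_succ]
    -- The bound records whether `T` has been passed: before that the two sides agree exactly, the
    -- single cycle straddling `T` creates the error, and afterwards nothing changes.
    by_cases h1 : delivery Y Z n ω ≤ T
    · rw [if_pos h1] at ih ⊢
      rw [min_eq_right h1] at ih
      have ih' := sub_eq_zero.mp (abs_nonpos_iff.mp ih)
      rw [← ih', ← integral_cycle_sub ha hY hZ hg,
        intervalIntegral.integral_add_adjacent_intervals (hi le_rfl (hD _)) (hi (hD _) (hD _))]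
      by_cases h2 : delivery Y Z (n + 1) ω ≤ T
      · rw [if_pos h2, min_eq_right h2]; simp
      · rw [if_neg h2, min_eq_left (not_le.mp h2).le,
          intervalIntegral.integral_interval_sub_left (hi le_rfl hT) (hi le_rfl (hD _))]
        have hb := intervalIntegral.norm_integral_le_of_norm_le_const (C := C)
          (f := fun t => g (age Y Z ω t) - v) (a := delivery Y Z (n + 1) ω) (b := T) (by
            intro t ht
            rw [Set.uIoc_of_ge (not_le.mp h2).le] at ht
            exact hC _ (age_mem ha hY hZ (hT.trans ht.1.le)))
        rw [Real.norm_eq_abs] at hb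
        refine hb.trans (mul_le_mul_of_nonneg_left ?_ ?_)
        · rw [abs_of_nonpos (by linarith)]
          linarith [delivery_le_add hY hZ n]
        · exact (abs_nonneg _).trans (hC _ (age_mem ha hY hZ hT))
    · rw [if_neg h1] at ih ⊢
      have h2 : ¬ delivery Y Z (n + 1) ω ≤ T := fun h => h1 (hlt.le.trans h)
      rw [if_neg h2]
      rw [min_eq_left (not_le.mp h2).le, add_zero]
      rwa [min_eq_left (not_le.mp h1).le] at ih

/-- Shifting the stopping rule by one cycle changes the sum by at most one term. -/
lemma abs_sum_delivery_shift_le (ha : 0 < a) (hY : ∀ j, Y j ω ∈ Set.Icc a b)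
    (hZ : ∀ j, Z j ω ∈ Set.Icc 0 M) {m : ℝ → ℝ} {C T : ℝ}
    (hC : ∀ y ∈ Set.Icc a b, |m y| ≤ C) (n : ℕ) :
    |(∑ j ∈ Finset.range n, if delivery Y Z (j + 1) ω ≤ T then m (Y (j + 1) ω) else 0)
      - ∑ j ∈ Finset.range n, if delivery Y Z j ω ≤ T then m (Y (j + 1) ω) else 0|
      ≤ if delivery Y Z n ω ≤ T then 0 else C := by
  have hmono := strictMono_delivery ha hY hZ
  have hC0 : 0 ≤ C := (abs_nonneg _).trans (hC _ (hY 0))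
  induction n with
  | zero =>
    simp only [Finset.range_zero, Finset.sum_empty, sub_self, abs_zero]
    split_ifs <;> simp [hC0]
  | succ n ih =>
    have hlt : delivery Y Z n ω < delivery Y Z (n + 1) ω := hmono (Nat.lt_succ_self n)
    rw [Finset.sum_range_succ, Finset.sum_range_succ, add_sub_add_comm]
    by_cases h1 : delivery Y Z n ω ≤ T
    · rw [if_pos h1] at ih ⊢
      rw [abs_nonpos_iff.mp ih, zero_add]
      by_cases h2 : delivery Y Z (n + 1) ω ≤ T
      · simp [h2]
      · simpa [h2] using hC _ (hY (n + 1))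
    · have h2 : ¬ delivery Y Z (n + 1) ω ≤ T := fun h => h1 (hlt.le.trans h)
      rw [if_neg h1] at ih
      simpa [h1, h2] using ih

end Paths

/-! ### The exponential law: integral identity and moments -/

section Exponential

open scoped ENNReal

lemma expMeasure_Ioi {r s : ℝ} (hr : 0 < r) (hs : 0 ≤ s) :
    expMeasure r (Set.Ioi s) = ENNReal.ofReal (Real.exp (-(r * s))) := by
  have := isProbabilityMeasure_expMeasure hr
  have h1 : expMeasure r (Set.Iic s) = ENNReal.ofReal (1 - Real.exp (-(r * s))) := by
    rw [expMeasure, gammaMeasure, withDensity_apply _ measurableSet_Iic]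
    exact (lintegral_exponentialPDF_eq_antiDeriv hr s).trans (by rw [if_pos hs])
  have h2 : Real.exp (-(r * s)) ≤ 1 := Real.exp_le_one_iff.mpr (by nlinarith)
  rw [← Set.compl_Iic, prob_compl_eq_one_sub measurableSet_Iic, h1, ← ENNReal.ofReal_one,
    ← ENNReal.ofReal_sub _ (by linarith)]
  congr 1; ring

lemma ae_nonneg_expMeasure (r : ℝ) : ∀ᵐ x ∂expMeasure r, 0 ≤ x := by
  have : expMeasure r (Set.Iio 0) = 0 := by
    rw [expMeasure, gammaMeasure, withDensity_apply _ measurableSet_Iio]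
    exact lintegral_exponentialPDF_of_nonpos le_rfl
  rw [ae_iff]
  convert this using 2
  ext x; simp

/-- Memorylessness in integrated form: the mean of `F` at an exponential time is the rate times the
mean of the integral of `F` up to that time. -/
lemma lintegral_expMeasure {r : ℝ} (hr : 0 < r) {F : ℝ → ℝ≥0∞} (hF : Measurable F) :
    ∫⁻ x, F x ∂expMeasure r
      = ENNReal.ofReal r * ∫⁻ x, (∫⁻ s in Set.Ioo 0 x, F s) ∂expMeasure r := by
  have := isProbabilityMeasure_expMeasure hr
  have hset : MeasurableSet {p : ℝ × ℝ | p.2 ∈ Set.Ioo 0 p.1} :=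
    (measurableSet_lt measurable_const measurable_snd).inter
      (measurableSet_lt measurable_snd measurable_fst)
  have hpdf : Measurable (exponentialPDF r) := (measurable_exponentialPDFReal r).ennreal_ofReal
  have hleft : ∫⁻ x, F x ∂expMeasure r = ∫⁻ x, exponentialPDF r x * F x :=
    lintegral_withDensity_eq_lintegral_mul _ hpdf hF
  have hright : ∫⁻ x, (∫⁻ s in Set.Ioo 0 x, F s) ∂expMeasure r
      = ∫⁻ s, (Set.Ioi 0).indicator (fun s => ENNReal.ofReal (Real.exp (-(r * s))) * F s) s := by
    have h1 : ∀ x, ∫⁻ s in Set.Ioo 0 x, F s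
        = ∫⁻ s, {p : ℝ × ℝ | p.2 ∈ Set.Ioo 0 p.1}.indicator (fun p => F p.2) (x, s) := by
      intro x
      rw [← lintegral_indicator measurableSet_Ioo]
      rfl
    simp_rw [h1]
    -- By Tonelli, `F s` is weighted by the tail probability `exp (-(r * s))`, which is the
    -- exponential density divided by `r`.
    rw [lintegral_lintegral_swap
      (f := fun x s => {p : ℝ × ℝ | p.2 ∈ Set.Ioo 0 p.1}.indicator (fun p => F p.2) (x, s))
      (((hF.comp measurable_snd).indicator hset).aemeasurable)]
    refine lintegral_congr fun s => ?_
    by_cases hs : 0 < s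
    · rw [Set.indicator_of_mem (Set.mem_Ioi.mpr hs), ← expMeasure_Ioi hr hs.le, mul_comm,
        ← lintegral_indicator_const measurableSet_Ioi]
      refine lintegral_congr fun x => ?_
      simp [Set.indicator, hs]
    · rw [Set.indicator_of_notMem (by simpa using hs)]
      simp [hs]
  have hmeas : Measurable ((Set.Ioi (0 : ℝ)).indicator
      fun s => ENNReal.ofReal (Real.exp (-(r * s))) * F s) :=
    Measurable.indicator (by fun_prop) measurableSet_Ioi
  rw [hleft, hright, ← lintegral_const_mul _ hmeas]
  refine lintegral_congr_ae ?_
  filter_upwards [Measure.ae_ne volume (0 : ℝ)] with s hs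
  rcases lt_or_gt_of_ne hs with h | h
  · rw [exponentialPDF_of_neg h, Set.indicator_of_notMem (by simpa using h.le)]; simp
  · rw [exponentialPDF_of_nonneg h.le, Set.indicator_of_mem (Set.mem_Ioi.mpr h),
      ENNReal.ofReal_mul hr.le, mul_assoc]

/-- The case `F = 1` of `lintegral_expMeasure` reads `1 = r * E[X]`. -/
lemma lintegral_ofReal_expMeasure {r : ℝ} (hr : 0 < r) :
    ∫⁻ x, ENNReal.ofReal x ∂expMeasure r = ENNReal.ofReal (1 / r) := by
  have := isProbabilityMeasure_expMeasure hr
  have h := lintegral_expMeasure hr (F := fun _ => 1) measurable_const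
  simp only [lintegral_const, measure_univ, mul_one, Measure.restrict_apply MeasurableSet.univ,
    Set.univ_inter, Real.volume_Ioo, sub_zero, one_mul] at h
  rw [one_div, ENNReal.ofReal_inv_of_pos hr]
  exact ENNReal.eq_inv_of_mul_eq_one_left (by rw [mul_comm]; exact h.symm)

/-- The case `F x = 2 * x` of `lintegral_expMeasure` reads `2 * E[X] = r * E[X ^ 2]`. -/
lemma lintegral_ofReal_sq_expMeasure {r : ℝ} (hr : 0 < r) :
    ∫⁻ x, ENNReal.ofReal (x ^ 2) ∂expMeasure r = ENNReal.ofReal (2 / r ^ 2) := by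
  have h := lintegral_expMeasure hr (F := fun x => ENNReal.ofReal (2 * x))
    (by fun_prop)
  have h1 : ∫⁻ x, (∫⁻ s in Set.Ioo 0 x, ENNReal.ofReal (2 * s)) ∂expMeasure r
      = ∫⁻ x, ENNReal.ofReal (x ^ 2) ∂expMeasure r := by
    refine lintegral_congr_ae ?_
    filter_upwards [ae_nonneg_expMeasure r] with x hx
    rw [← ofReal_integral_eq_lintegral_ofReal, ← integral_Ioc_eq_integral_Ioo,
      ← intervalIntegral.integral_of_le hx]
    · rw [intervalIntegral.integral_const_mul, integral_id]
      congr 1; ring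
    · exact ((continuous_const.mul continuous_id).integrableOn_Icc).mono_set Set.Ioo_subset_Icc_self
    · filter_upwards [ae_restrict_mem measurableSet_Ioo] with s hs
      simpa using hs.1.le
  rw [h1] at h
  simp_rw [ENNReal.ofReal_mul (zero_le_two (α := ℝ))] at h
  rw [lintegral_const_mul _ (by fun_prop), lintegral_ofReal_expMeasure hr] at h
  have hr0 : ENNReal.ofReal r ≠ 0 := by simpa using hr
  have h2 : ∫⁻ x, ENNReal.ofReal (x ^ 2) ∂expMeasure r
      = (ENNReal.ofReal r)⁻¹ * (ENNReal.ofReal 2 * ENNReal.ofReal (1 / r)) := by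
    rw [h, ← mul_assoc, ENNReal.inv_mul_cancel hr0 ENNReal.ofReal_ne_top, one_mul]
  rw [h2, ← ENNReal.ofReal_inv_of_pos hr, ← ENNReal.ofReal_mul (by norm_num),
    ← ENNReal.ofReal_mul (by positivity)]
  congr 1
  field_simp

lemma memLp_id_expMeasure {r : ℝ} (hr : 0 < r) : MemLp id 2 (expMeasure r) := by
  rw [memLp_two_iff_integrable_sq measurable_id.aestronglyMeasurable]
  refine ⟨(measurable_id.pow_const 2).aestronglyMeasurable, ?_⟩
  rw [hasFiniteIntegral_iff_ofReal (Eventually.of_forall fun x => sq_nonneg _)]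
  simp only [id]
  rw [lintegral_ofReal_sq_expMeasure hr]
  exact ENNReal.ofReal_lt_top

lemma integral_id_expMeasure {r : ℝ} (hr : 0 < r) : ∫ x, x ∂expMeasure r = 1 / r := by
  rw [integral_eq_lintegral_of_nonneg_ae (ae_nonneg_expMeasure r)
    measurable_id'.aestronglyMeasurable, lintegral_ofReal_expMeasure hr,
    ENNReal.toReal_ofReal (by positivity)]

lemma variance_id_expMeasure {r : ℝ} (hr : 0 < r) : Var[id; expMeasure r] = 1 / r ^ 2 := by
  have := isProbabilityMeasure_expMeasure hr
  rw [variance_eq_sub (memLp_id_expMeasure hr)]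
  have h1 : ∫ x, (id ^ 2 : ℝ → ℝ) x ∂expMeasure r = 2 / r ^ 2 := by
    simp only [Pi.pow_apply, id]
    rw [integral_eq_lintegral_of_nonneg_ae (Eventually.of_forall fun x => sq_nonneg _)
      (measurable_id'.pow_const 2).aestronglyMeasurable, lintegral_ofReal_sq_expMeasure hr,
      ENNReal.toReal_ofReal (by positivity)]
  have h2 : ∫ x, id x ∂expMeasure r = 1 / r := integral_id_expMeasure hr
  rw [h1, h2]
  ring

end Exponential

/-! ### Arrival times: moments and deviations -/

section Poisson

open scoped ENNReal

variable {Ω : Type*} [MeasurableSpace Ω] {μ : Measure Ω} {r : ℝ} {Q : ℕ → Ω → ℝ}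

lemma IsPoissonArrivals.eq_sum_gaps (hQ : IsPoissonArrivals μ r Q) (n : ℕ) :
    Q n = ∑ k ∈ Finset.range n, fun ω => Q (k + 1) ω - Q k ω := by
  ext ω
  rw [Finset.sum_apply, Finset.sum_range_sub (fun k => Q k ω), hQ.origin, sub_zero]

lemma IsPoissonArrivals.memLp_gap (hQ : IsPoissonArrivals μ r Q) (k : ℕ) :
    MemLp (fun ω => Q (k + 1) ω - Q k ω) 2 μ := by
  have h := memLp_id_expMeasure hQ.rate_pos
  rw [← (hQ.gap_law k).map_eq] at h
  exact (memLp_map_measure_iff measurable_id.aestronglyMeasurable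
    (hQ.gap_law k).aemeasurable).mp h

lemma IsPoissonArrivals.memLp (hQ : IsPoissonArrivals μ r Q) (n : ℕ) : MemLp (Q n) 2 μ := by
  rw [hQ.eq_sum_gaps n]
  exact memLp_finsetSum' _ fun k _ => hQ.memLp_gap k

variable [IsProbabilityMeasure μ]

lemma IsPoissonArrivals.integrable (hQ : IsPoissonArrivals μ r Q) (n : ℕ) :
    Integrable (Q n) μ := (hQ.memLp n).integrable (by norm_num)

lemma IsPoissonArrivals.integral_eq (hQ : IsPoissonArrivals μ r Q) (n : ℕ) :
    ∫ ω, Q n ω ∂μ = n / r := by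
  rw [hQ.eq_sum_gaps n]
  simp only [Finset.sum_apply]
  rw [integral_finsetSum _ fun k _ => (hQ.memLp_gap k).integrable (by norm_num)]
  have : ∀ k, ∫ ω, (Q (k + 1) ω - Q k ω) ∂μ = 1 / r := fun k =>
    (hQ.gap_law k).integral_eq.trans (integral_id_expMeasure hQ.rate_pos)
  simp only [this, Finset.sum_const, Finset.card_range, nsmul_eq_mul]
  ring

lemma IsPoissonArrivals.integral_sq_sub (hQ : IsPoissonArrivals μ r Q) (n : ℕ) :
    ∫ ω, (Q n ω - n / r) ^ 2 ∂μ = n / r ^ 2 := by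
  have h1 : Var[Q n; μ] = n / r ^ 2 := by
    rw [hQ.eq_sum_gaps n, IndepFun.variance_sum (fun k _ => hQ.memLp_gap k)
      (fun i _ j _ hij => hQ.gap_indep.indepFun hij)]
    simp only [(hQ.gap_law _).variance_eq, variance_id_expMeasure hQ.rate_pos, Finset.sum_const,
      Finset.card_range, nsmul_eq_mul]
    ring
  rw [← h1, variance_eq_integral (hQ.measurable n).aemeasurable, hQ.integral_eq]

lemma IsPoissonArrivals.integrable_sq_sub (hQ : IsPoissonArrivals μ r Q) (n : ℕ) :
    Integrable (fun ω => (Q n ω - n / r) ^ 2) μ :=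
  ((hQ.memLp n).sub (memLp_const _)).integrable_sq

lemma IsPoissonArrivals.integrable_posPart (hQ : IsPoissonArrivals μ r Q) (n : ℕ) (c : ℝ) :
    Integrable (fun ω => max (Q n ω - c) 0) μ :=
  ((hQ.integrable n).sub (integrable_const c)).pos_part

/-- With `u = Q n - n / r` and `c = n / r`, the inequality `(u - 2 * c) ^ 2 ≥ 0` gives `max (u - c)
0 ≤ u ^ 2 / (4 * c)`. The variance is `n / r ^ 2`, so the bound does not grow with `n`. -/
lemma IsPoissonArrivals.integral_posPart_le (hQ : IsPoissonArrivals μ r Q) {n : ℕ} (hn : 0 < n) :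
    ∫ ω, max (Q n ω - 2 * (n / r)) 0 ∂μ ≤ 1 / (4 * r) := by
  have hr := hQ.rate_pos
  have hn' : (0 : ℝ) < n := by exact_mod_cast hn
  have ha : 0 < (n : ℝ) / r := by positivity
  calc ∫ ω, max (Q n ω - 2 * (n / r)) 0 ∂μ
      ≤ ∫ ω, (Q n ω - n / r) ^ 2 / (4 * (n / r)) ∂μ := by
        refine integral_mono (hQ.integrable_posPart n _) ((hQ.integrable_sq_sub n).div_const _)
          fun ω => ?_
        simp only
        refine max_le ?_ (by positivity)
        rw [le_div_iff₀ (by positivity)]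
        nlinarith [sq_nonneg (Q n ω - n / r - 2 * (n / r))]
    _ = 1 / (4 * r) := by
        rw [integral_div, hQ.integral_sq_sub]
        field_simp

/-- Chebyshev's inequality. The rate `4 / n` is what keeps the total error bounded when it is summed
over a number of cycles proportional to `n`. -/
lemma IsPoissonArrivals.prob_lt_le (hQ : IsPoissonArrivals μ r Q) {n : ℕ} (hn : 0 < n) :
    μ.real {ω | Q n ω < n / r / 2} ≤ 4 / n := by
  have hr := hQ.rate_pos
  have hn' : (0 : ℝ) < n := by exact_mod_cast hn
  have ha : 0 < (n : ℝ) / r := by positivity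
  have hs : MeasurableSet {ω | Q n ω < n / r / 2} :=
    measurableSet_lt (hQ.measurable n) measurable_const
  rw [← integral_indicator_one hs]
  calc ∫ ω, {ω | Q n ω < n / r / 2}.indicator (1 : Ω → ℝ) ω ∂μ
      ≤ ∫ ω, (Q n ω - n / r) ^ 2 * (4 / (n / r) ^ 2) ∂μ := by
        refine integral_mono ((integrable_const (1 : ℝ)).indicator hs)
          ((hQ.integrable_sq_sub n).mul_const _) fun ω => ?_
        refine Set.indicator_apply_le' (fun hω => ?_) fun _ => by positivity
        have hω' : Q n ω < n / r / 2 := hω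
        rw [Pi.one_apply, mul_div_assoc', le_div_iff₀ (by positivity)]
        nlinarith
    _ = 4 / n := by
        rw [integral_mul_const, hQ.integral_sq_sub]
        field_simp

/-- The mean of a function of an independent exponential time is the rate times the mean of its
integral up to that time. -/
lemma lintegral_indep_exponential {α : Type*} [MeasurableSpace α] (hr : 0 < r) {X : Ω → ℝ}
    {H : Ω → α} (hX : Measurable X) (hH : Measurable H) (hlaw : μ.map X = expMeasure r)
    (hind : IndepFun X H μ) {F : α → ℝ → ℝ≥0∞} (hF : Measurable (Function.uncurry F)) :
    ∫⁻ ω, F (H ω) (X ω) ∂μ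
      = ENNReal.ofReal r * ∫⁻ ω, (∫⁻ s in Set.Ioo 0 (X ω), F (H ω) s) ∂μ := by
  have := isProbabilityMeasure_expMeasure hr
  have hmap : μ.map (fun ω => (H ω, X ω)) = (μ.map H).prod (expMeasure r) := by
    rw [hind.symm.map_prod_eq_prod_map_map hH.aemeasurable hX.aemeasurable, hlaw]
  have hset : MeasurableSet {p : (α × ℝ) × ℝ | p.2 ∈ Set.Ioo 0 p.1.2} :=
    (measurableSet_lt measurable_const measurable_snd).inter
      (measurableSet_lt measurable_snd (by fun_prop))
  have hF' : Measurable fun p : α × ℝ => ∫⁻ s in Set.Ioo 0 p.2, F p.1 s := by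
    have h1 : ∀ p : α × ℝ, ∫⁻ s in Set.Ioo 0 p.2, F p.1 s
        = ∫⁻ s, {p : (α × ℝ) × ℝ | p.2 ∈ Set.Ioo 0 p.1.2}.indicator
            (fun p => F p.1.1 p.2) (p, s) := by
      intro x
      rw [← lintegral_indicator measurableSet_Ioo]
      rfl
    simp_rw [h1]
    exact Measurable.lintegral_prod_right' (Measurable.indicator
      (hF.comp ((measurable_fst.comp measurable_fst).prodMk measurable_snd)) hset)
  have hHX : Measurable fun ω => (H ω, X ω) := hH.prodMk hX
  have h1 : ∫⁻ ω, F (H ω) (X ω) ∂μ = ∫⁻ h, ∫⁻ x, F h x ∂expMeasure r ∂(μ.map H) := by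
    rw [← lintegral_prod (fun p : α × ℝ => F p.1 p.2) hF.aemeasurable, ← hmap,
      lintegral_map (f := fun p : α × ℝ => F p.1 p.2) hF hHX]
  have h2 : ∫⁻ ω, (∫⁻ s in Set.Ioo 0 (X ω), F (H ω) s) ∂μ
      = ∫⁻ h, ∫⁻ x, (∫⁻ s in Set.Ioo 0 x, F h s) ∂expMeasure r ∂(μ.map H) := by
    rw [← lintegral_prod (fun p : α × ℝ => ∫⁻ s in Set.Ioo 0 p.2, F p.1 s) hF'.aemeasurable,
      ← hmap, lintegral_map hF' hHX]
  rw [h1, h2, ← lintegral_const_mul _ (by exact Measurable.lintegral_prod_right' hF')]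
  exact lintegral_congr fun h => lintegral_expMeasure hr hF.of_uncurry_left

end Poisson

/-! ### Regular systems; Poisson arrivals see time averages -/

/-- Delays, queries and waiting periods with all bounds valid everywhere. The fields
`delay_indep` and `nonanticipating` are the consequences of causality that the analysis uses: a
delay is independent of the preceding delays and waiting periods and of all queries, and up to the
next query the age is determined by data independent of the gap before that query. -/
structure RegularSystem {Ω : Type*} [mΩ : MeasurableSpace Ω] (μ : Measure Ω) (ν : Measure ℝ)
    (r a b M : ℝ) (Y Q Z : ℕ → Ω → ℝ) : Prop where
  lower_pos : 0 < a
  wait_bound_nonneg : 0 ≤ M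
  delay_measurable : ∀ j, Measurable (Y j)
  wait_measurable : ∀ j, Measurable (Z j)
  delay_mem : ∀ j ω, Y j ω ∈ Set.Icc a b
  wait_mem : ∀ j ω, Z j ω ∈ Set.Icc 0 M
  delay_law : ∀ j, μ.map (Y j) = ν
  poisson : IsPoissonArrivals μ r Q
  query_mono : ∀ ω, Monotone fun k => Q k ω
  delay_indep : ∀ j, ∃ m : MeasurableSpace Ω, m ≤ mΩ ∧
    Indep (MeasurableSpace.comap (Y (j + 1)) inferInstance) m μ ∧
    (∀ i ≤ j, Measurable[m] (Y i)) ∧ (∀ i ≤ j, Measurable[m] (Z i)) ∧ ∀ k, Measurable[m] (Q k)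
  nonanticipating : ∀ k, ∃ Z' : ℕ → Ω → ℝ, (∀ j, Measurable (Z' j)) ∧
    IndepFun (fun ω => Q (k + 1) ω - Q k ω)
      (fun ω => ((fun j => Y j ω : ℕ → ℝ), (fun j => Z' j ω : ℕ → ℝ), Q k ω)) μ ∧
    ∀ ω t, 0 ≤ t → t ≤ Q (k + 1) ω → age Y Z ω t = age Y Z' ω t

section General

variable {Ω Ω' : Type*}

lemma delivery_comp (Y Z : ℕ → Ω' → ℝ) (f : Ω → Ω') (j : ℕ) (ω : Ω) :
    delivery (fun j ω => Y j (f ω)) (fun j ω => Z j (f ω)) j ω = delivery Y Z j (f ω) := by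
  induction j with
  | zero => rfl
  | succ j ih => rw [delivery_succ, delivery_succ, ih]

lemma age_comp (Y Z : ℕ → Ω' → ℝ) (f : Ω → Ω') (ω : Ω) (t : ℝ) :
    age (fun j ω => Y j (f ω)) (fun j ω => Z j (f ω)) ω t = age Y Z (f ω) t := by
  simp only [age, request, delivery_comp]

lemma measurable_delivery_of_le {m : MeasurableSpace Ω} {Y Z : ℕ → Ω → ℝ} {j : ℕ}
    (hY : ∀ i ≤ j, Measurable (Y i)) (hZ : ∀ i < j, Measurable (Z i)) :
    Measurable (delivery Y Z j) := by
  induction j with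
  | zero => exact measurable_const
  | succ j ih =>
    exact ((ih (fun i hi => hY i (by omega)) fun i hi => hZ i (by omega)).add
      (hZ j (by omega))).add (hY (j + 1) le_rfl)

lemma measurable_intervalIntegral [MeasurableSpace Ω] {f : Ω → ℝ → ℝ}
    (hf : Measurable (Function.uncurry f)) {u w : Ω → ℝ} (hu : Measurable u) (hw : Measurable w) :
    Measurable fun ω => ∫ t in u ω..w ω, f ω t := by
  have key : ∀ {u w : Ω → ℝ}, Measurable u → Measurable w →
      Measurable fun ω => ∫ t in Set.Ioc (u ω) (w ω), f ω t := by
    intro u w hu hw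
    have hset : MeasurableSet {p : Ω × ℝ | p.2 ∈ Set.Ioc (u p.1) (w p.1)} :=
      (measurableSet_lt (hu.comp measurable_fst) measurable_snd).inter
        (measurableSet_le measurable_snd (hw.comp measurable_fst))
    have e : (fun ω => ∫ t in Set.Ioc (u ω) (w ω), f ω t) = fun ω => ∫ t,
        {p : Ω × ℝ | p.2 ∈ Set.Ioc (u p.1) (w p.1)}.indicator (Function.uncurry f) (ω, t) :=
      funext fun ω => (integral_indicator measurableSet_Ioc).symm
    rw [e]
    exact (StronglyMeasurable.integral_prod_right'
      (hf.indicator hset).stronglyMeasurable).measurable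
  exact (key hu hw).sub (key hw hu)

lemma integral_indepFun [MeasurableSpace Ω] {μ : Measure Ω} [IsProbabilityMeasure μ] {α : Type*}
    [MeasurableSpace α] {ν : Measure ℝ} {X : Ω → ℝ} {H : Ω → α} (hX : Measurable X)
    (hH : Measurable H) (hlaw : μ.map X = ν) (hind : IndepFun X H μ) {F : α → ℝ → ℝ}
    (hF : Measurable (Function.uncurry F)) (h_int : Integrable (fun ω => F (H ω) (X ω)) μ) :
    ∫ ω, F (H ω) (X ω) ∂μ = ∫ ω, (∫ x, F (H ω) x ∂ν) ∂μ := by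
  have : IsProbabilityMeasure ν := hlaw ▸ Measure.isProbabilityMeasure_map hX.aemeasurable
  have hmap : μ.map (fun ω => (H ω, X ω)) = (μ.map H).prod ν := by
    rw [hind.symm.map_prod_eq_prod_map_map hH.aemeasurable hX.aemeasurable, hlaw]
  have hHX : Measurable fun ω => (H ω, X ω) := hH.prodMk hX
  have h_int' : Integrable (Function.uncurry F) ((μ.map H).prod ν) := by
    rw [← hmap, integrable_map_measure hF.aestronglyMeasurable hHX.aemeasurable]
    exact h_int
  have h1 : ∫ ω, F (H ω) (X ω) ∂μ = ∫ p, Function.uncurry F p ∂(μ.map H).prod ν := by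
    rw [← hmap, integral_map hHX.aemeasurable hF.aestronglyMeasurable]
    rfl
  rw [h1, integral_prod _ h_int', integral_map hH.aemeasurable]
  · rfl
  · exact (StronglyMeasurable.integral_prod_right' hF.stronglyMeasurable).aestronglyMeasurable

end General

namespace RegularSystem

variable {Ω : Type*} [mΩ : MeasurableSpace Ω] {μ : Measure Ω}
  {ν : Measure ℝ} {r a b M : ℝ} {Y Q Z : ℕ → Ω → ℝ}

lemma query_nonneg (h : RegularSystem μ ν r a b M Y Q Z) (k : ℕ) (ω : Ω) : 0 ≤ Q k ω := by
  rw [← h.poisson.origin ω]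
  exact h.query_mono ω (Nat.zero_le k)

lemma measurable_delivery (h : RegularSystem μ ν r a b M Y Q Z) (j : ℕ) :
    Measurable (delivery Y Z j) :=
  PullOrWait.measurable_delivery h.delay_measurable h.wait_measurable j

lemma delivery_nonneg (h : RegularSystem μ ν r a b M Y Q Z) (j : ℕ) (ω : Ω) :
    0 ≤ delivery Y Z j ω :=
  PullOrWait.delivery_nonneg h.lower_pos (h.delay_mem · ω) (h.wait_mem · ω) j

lemma measurable_integral_age (h : RegularSystem μ ν r a b M Y Q Z) {f : ℝ → ℝ}
    (hf : Continuous f) {u w : Ω → ℝ} (hu : Measurable u) (hw : Measurable w)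
    (hu0 : ∀ ω, 0 ≤ u ω) (hw0 : ∀ ω, 0 ≤ w ω) :
    Measurable fun ω => ∫ t in u ω..w ω, f (age Y Z ω t) := by
  have e : (fun ω => ∫ t in u ω..w ω, f (age Y Z ω t))
      = fun ω => ∫ t in u ω..w ω, f (age Y Z ω (max t 0)) := by
    ext ω
    refine intervalIntegral.integral_congr fun t ht => ?_
    have : 0 ≤ t := (le_min (hu0 ω) (hw0 ω)).trans (by rw [Set.uIcc] at ht; exact ht.1)
    simp only [max_eq_left this]
  rw [e]
  exact measurable_intervalIntegral (f := fun ω t => f (age Y Z ω (max t 0)))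
    (hf.measurable.comp (measurable_age h.delay_measurable h.wait_measurable)) hu hw

lemma abs_integral_age_le (h : RegularSystem μ ν r a b M Y Q Z) {f : ℝ → ℝ} {C : ℝ}
    (hC : ∀ x ∈ Set.Icc 0 (M + 2 * b), |f x| ≤ C) {s t : ℝ} (hs : 0 ≤ s) (ht : 0 ≤ t) (ω : Ω) :
    |∫ t in s..t, f (age Y Z ω t)| ≤ C * |t - s| := by
  rw [← Real.norm_eq_abs]
  refine intervalIntegral.norm_integral_le_of_norm_le_const (C := C) fun u hu => ?_
  rw [Set.uIoc, Set.mem_Ioc] at hu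
  exact hC _ (age_mem h.lower_pos (h.delay_mem · ω) (h.wait_mem · ω)
    ((le_min hs ht).trans hu.1.le))

lemma integrable_integral_age (h : RegularSystem μ ν r a b M Y Q Z) {f : ℝ → ℝ}
    (hf : Continuous f) {u w : Ω → ℝ} (hu : Measurable u) (hw : Measurable w)
    (hu0 : ∀ ω, 0 ≤ u ω) (hw0 : ∀ ω, 0 ≤ w ω) (hui : Integrable u μ) (hwi : Integrable w μ) :
    Integrable (fun ω => ∫ t in u ω..w ω, f (age Y Z ω t)) μ := by
  obtain ⟨C, hC⟩ := isCompact_Icc.exists_bound_of_continuousOn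
    (hf.continuousOn (s := Set.Icc 0 (M + 2 * b)))
  refine Integrable.mono' ((hwi.sub hui).abs.const_mul C)
    (h.measurable_integral_age hf hu hw hu0 hw0).aestronglyMeasurable ?_
  exact Eventually.of_forall fun ω => h.abs_integral_age_le hC (hu0 ω) (hw0 ω) ω

lemma measurable_age_query (h : RegularSystem μ ν r a b M Y Q Z) {g : ℝ → ℝ}
    (hg : Continuous g) (k : ℕ) : Measurable fun ω => g (age Y Z ω (Q k ω)) := by
  have := hg.measurable.comp ((measurable_age h.delay_measurable h.wait_measurable).comp
    (measurable_id.prodMk (h.poisson.measurable k)))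
  simpa [Function.comp_def, max_eq_left (h.query_nonneg k _)] using this

variable [IsProbabilityMeasure μ]

/-- Poisson arrivals see time averages, between two consecutive queries. -/
lemma integral_age_query_succ (h : RegularSystem μ ν r a b M Y Q Z) {g : ℝ → ℝ}
    (hg : Continuous g) (hg0 : ∀ x, 0 ≤ g x) (k : ℕ) :
    ∫ ω, g (age Y Z ω (Q (k + 1) ω)) ∂μ
      = r * ∫ ω, (∫ t in Q k ω..Q (k + 1) ω, g (age Y Z ω t)) ∂μ := by
  obtain ⟨Z', hZ', hind, hage⟩ := h.nonanticipating k
  have hr := h.poisson.rate_pos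
  have hQm := h.poisson.measurable
  -- `H` gathers all data needed to compute the age until the next query; by `nonanticipating` it is
  -- independent of the gap to that query. The age is rebuilt as a deterministic function `A` of
  -- these data.
  set H : Ω → (ℕ → ℝ) × (ℕ → ℝ) × ℝ := fun ω => (fun j => Y j ω, fun j => Z' j ω, Q k ω) with hHd
  have hHm : Measurable H := (measurable_pi_lambda _ h.delay_measurable).prodMk
    ((measurable_pi_lambda _ hZ').prodMk (hQm k))
  set A : (ℕ → ℝ) × (ℕ → ℝ) × ℝ → ℝ → ℝ :=
    age (fun j (p : (ℕ → ℝ) × (ℕ → ℝ) × ℝ) => p.1 j) (fun j p => p.2.1 j) with hA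
  have hAm : Measurable fun p : ((ℕ → ℝ) × (ℕ → ℝ) × ℝ) × ℝ => A p.1 (max p.2 0) :=
    measurable_age (fun j => by fun_prop) (fun j => by fun_prop)
  have hAH : ∀ ω t, A (H ω) t = age Y Z' ω t := fun ω t => (age_comp _ _ H ω t).symm
  set F : (ℕ → ℝ) × (ℕ → ℝ) × ℝ → ℝ → ENNReal :=
    fun p s => ENNReal.ofReal (g (A p (max (p.2.2 + s) 0))) with hF
  have hFm : Measurable (Function.uncurry F) := by
    refine (hg.measurable.comp ?_).ennreal_ofReal
    exact hAm.comp (measurable_fst.prodMk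
      (by fun_prop : Measurable fun p : ((ℕ → ℝ) × (ℕ → ℝ) × ℝ) × ℝ => p.1.2.2 + p.2))
  have hFeq : ∀ ω s, 0 ≤ s → s ≤ Q (k + 1) ω - Q k ω →
      F (H ω) s = ENNReal.ofReal (g (age Y Z ω (Q k ω + s))) := by
    intro ω s hs hs'
    have h0 : 0 ≤ Q k ω + s := add_nonneg (h.query_nonneg k ω) hs
    simp only [hF]
    rw [hAH, hHd]
    simp only
    -- The surrogate policy gives the true age up to and including `Q (k + 1)`; the endpoint is
    -- needed because the penalty is sampled there.
    rw [max_eq_left h0, hage ω _ h0 (by linarith)]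
  have hle : ∀ ω, Q k ω ≤ Q (k + 1) ω := fun ω => h.query_mono ω (Nat.le_succ k)
  have key := lintegral_indep_exponential (μ := μ) (X := fun ω => Q (k + 1) ω - Q k ω) hr
    ((hQm (k + 1)).sub (hQm k)) hHm
    (h.poisson.gap_law k).map_eq hind hFm
  have hl : ∫⁻ ω, F (H ω) (Q (k + 1) ω - Q k ω) ∂μ
      = ∫⁻ ω, ENNReal.ofReal (g (age Y Z ω (Q (k + 1) ω))) ∂μ := by
    refine lintegral_congr fun ω => ?_
    rw [hFeq ω _ (by linarith [hle ω]) le_rfl]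
    congr 3; ring
  have hrr : ∫⁻ ω, (∫⁻ s in Set.Ioo 0 (Q (k + 1) ω - Q k ω), F (H ω) s) ∂μ
      = ∫⁻ ω, ENNReal.ofReal (∫ t in Q k ω..Q (k + 1) ω, g (age Y Z ω t)) ∂μ := by
    refine lintegral_congr fun ω => ?_
    have hii : IntervalIntegrable (fun s => g (age Y Z ω (Q k ω + s))) volume 0
        (Q (k + 1) ω - Q k ω) := by
      have := (intervalIntegrable_age (Y := Y) (Z := Z) (ω := ω) h.lower_pos (h.delay_mem · ω)
        (h.wait_mem · ω) hg (h.query_nonneg k ω) (h.query_nonneg (k + 1) ω)).comp_add_left (Q k ω)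
      simpa using this
    have e : ∫ t in Q k ω..Q (k + 1) ω, g (age Y Z ω t)
        = ∫ s in Set.Ioo 0 (Q (k + 1) ω - Q k ω), g (age Y Z ω (Q k ω + s)) := by
      rw [← integral_Ioc_eq_integral_Ioo,
        ← intervalIntegral.integral_of_le (by linarith [hle ω]),
        intervalIntegral.integral_comp_add_left (fun t => g (age Y Z ω t))]
      congr 1 <;> ring
    rw [e, ofReal_integral_eq_lintegral_ofReal
      ((intervalIntegrable_iff_integrableOn_Ioo_of_le (by linarith [hle ω])).mp hii)
      (Eventually.of_forall fun s => hg0 _)]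
    refine setLIntegral_congr_fun measurableSet_Ioo fun s hs => ?_
    exact hFeq ω s hs.1.le hs.2.le
  rw [hl, hrr] at key
  rw [integral_eq_lintegral_of_nonneg_ae (Eventually.of_forall fun ω => hg0 _)
      (h.measurable_age_query hg (k + 1)).aestronglyMeasurable, key,
    integral_eq_lintegral_of_nonneg_ae
      (Eventually.of_forall fun ω => intervalIntegral.integral_nonneg (hle ω) fun t _ => hg0 _)
      (h.measurable_integral_age hg (hQm k) (hQm (k + 1)) (h.query_nonneg k)
        (h.query_nonneg (k + 1))).aestronglyMeasurable, ENNReal.toReal_mul,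
    ENNReal.toReal_ofReal hr.le]

lemma integrable_age_query (h : RegularSystem μ ν r a b M Y Q Z) {g : ℝ → ℝ}
    (hg : Continuous g) (k : ℕ) : Integrable (fun ω => g (age Y Z ω (Q k ω))) μ := by
  obtain ⟨C, hC⟩ := isCompact_Icc.exists_bound_of_continuousOn
    (hg.continuousOn (s := Set.Icc 0 (M + 2 * b)))
  exact Integrable.of_bound (h.measurable_age_query hg k).aestronglyMeasurable C
    (Eventually.of_forall fun ω => hC _ (age_mem h.lower_pos (h.delay_mem · ω) (h.wait_mem · ω)
      (h.query_nonneg k ω)))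

/-- Poisson arrivals see time averages. -/
lemma integral_sum_age_query (h : RegularSystem μ ν r a b M Y Q Z) {g : ℝ → ℝ}
    (hg : Continuous g) (hg0 : ∀ x, 0 ≤ g x) (n : ℕ) :
    ∫ ω, (∑ k ∈ Finset.Icc 1 n, g (age Y Z ω (Q k ω))) ∂μ
      = r * ∫ ω, (∫ t in (0 : ℝ)..Q n ω, g (age Y Z ω t)) ∂μ := by
  have hQm := h.poisson.measurable
  rw [integral_finsetSum _ fun k _ => h.integrable_age_query hg k]
  induction n with
  | zero => simp [h.poisson.origin]
  | succ n ih =>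
    rw [Finset.sum_Icc_succ_top (by omega), ih, h.integral_age_query_succ hg hg0, ← mul_add,
      ← integral_add
        (h.integrable_integral_age hg measurable_const (hQm n) (fun _ => le_rfl) (h.query_nonneg n)
          (integrable_const _) (h.poisson.integrable n))
        (h.integrable_integral_age hg (hQm n) (hQm (n + 1)) (h.query_nonneg n)
          (h.query_nonneg (n + 1)) (h.poisson.integrable n) (h.poisson.integrable (n + 1)))]
    congr 2
    ext ω
    have hi : ∀ {s t : ℝ}, 0 ≤ s → 0 ≤ t →
        IntervalIntegrable (fun t => g (age Y Z ω t)) volume s t := fun hs ht =>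
      intervalIntegrable_age h.lower_pos (h.delay_mem · ω) (h.wait_mem · ω) hg hs ht
    exact intervalIntegral.integral_add_adjacent_intervals (hi le_rfl (h.query_nonneg n ω))
      (hi (h.query_nonneg n ω) (h.query_nonneg (n + 1) ω))

end RegularSystem

/-! ### Expected loss relative to the threshold rule -/

/-- The loss in one cycle from waiting `z` instead of following the threshold `x`. -/
noncomputable def cycleLoss (ν : Measure ℝ) (g : ℝ → ℝ) (v M x y z : ℝ) : ℝ :=
  meanCyclePenalty ν g v y z - meanCyclePenalty ν g v y (thresholdWait M x y)

/-- The expected loss in the first `n` cycles. -/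
noncomputable def cumulativeLoss {Ω : Type*} [MeasurableSpace Ω] (μ : Measure Ω) (ν : Measure ℝ)
    (g : ℝ → ℝ) (v M x : ℝ) (Y Z : ℕ → Ω → ℝ) (n : ℕ) : ℝ :=
  ∑ j ∈ Finset.range n, ∫ ω, cycleLoss ν g v M x (Y j ω) (Z j ω) ∂μ

/-- The value `v` and the threshold `x` solve the one-cycle optimality equation. -/
structure IsOptimalThreshold (ν : Measure ℝ) (g : ℝ → ℝ) (a b M v x : ℝ) : Prop where
  le : ∀ y ∈ Set.Icc a b, ∀ z ∈ Set.Icc 0 M,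
    meanCyclePenalty ν g v y (thresholdWait M x y) ≤ meanCyclePenalty ν g v y z
  integral_eq_zero : ∫ y, meanCyclePenalty ν g v y (thresholdWait M x y) ∂ν = 0

namespace RegularSystem

variable {Ω : Type*} [mΩ : MeasurableSpace Ω] {μ : Measure Ω}
  {ν : Measure ℝ} {r a b M v x : ℝ} {Y Q Z : ℕ → Ω → ℝ} {g : ℝ → ℝ}

lemma ae_law_mem (h : RegularSystem μ ν r a b M Y Q Z) : ∀ᵐ y ∂ν, y ∈ Set.Icc a b := by
  rw [← h.delay_law 0]
  refine (ae_map_iff (h.delay_measurable 0).aemeasurable measurableSet_Icc).mpr ?_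
  exact Eventually.of_forall fun ω => h.delay_mem 0 ω

lemma cycleLoss_nonneg (h : RegularSystem μ ν r a b M Y Q Z)
    (ho : IsOptimalThreshold ν g a b M v x) (j : ℕ) (ω : Ω) :
    0 ≤ cycleLoss ν g v M x (Y j ω) (Z j ω) :=
  sub_nonneg.mpr (ho.le _ (h.delay_mem j ω) _ (h.wait_mem j ω))

lemma cumulativeLoss_nonneg (h : RegularSystem μ ν r a b M Y Q Z)
    (ho : IsOptimalThreshold ν g a b M v x) (n : ℕ) : 0 ≤ cumulativeLoss μ ν g v M x Y Z n :=
  Finset.sum_nonneg fun j _ => integral_nonneg (h.cycleLoss_nonneg ho j)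

/-- `D j` is built from the delays and waits up to `j`, and all queries, even later ones, are
independent of the next delay. This permits weights that compare `D j` with `Q n`. -/
lemma indepFun_delay_succ (h : RegularSystem μ ν r a b M Y Q Z) (j n : ℕ) :
    IndepFun (Y (j + 1)) (fun ω => ((delivery Y Z j ω, Q n ω), (Y j ω, Z j ω))) μ := by
  obtain ⟨m, hm, hind, hYm, hZm, hQm⟩ := h.delay_indep j
  have hDm : Measurable[m] (delivery Y Z j) :=
    measurable_delivery_of_le hYm fun i hi => hZm i hi.le
  have hUm : Measurable[m] fun ω => ((delivery Y Z j ω, Q n ω), (Y j ω, Z j ω)) :=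
    (hDm.prodMk (hQm n)).prodMk ((hYm j le_rfl).prodMk (hZm j le_rfl))
  exact indep_of_indep_of_le_right hind hUm.comap_le

variable [IsProbabilityMeasure μ]

lemma isProbabilityMeasure_law (h : RegularSystem μ ν r a b M Y Q Z) : IsProbabilityMeasure ν :=
  h.delay_law 0 ▸ Measure.isProbabilityMeasure_map (h.delay_measurable 0).aemeasurable

lemma integrable_weight_mul (h : RegularSystem μ ν r a b M Y Q Z) {φ : Ω → ℝ} (hφ : Measurable φ)
    (hφ1 : ∀ ω, |φ ω| ≤ 1) {F : ℝ × ℝ × ℝ → ℝ} (hF : Continuous F) (i j k : ℕ) :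
    Integrable (fun ω => φ ω * F (Y i ω, Z j ω, Y k ω)) μ := by
  obtain ⟨C, hC⟩ := (isCompact_Icc.prod (isCompact_Icc.prod isCompact_Icc)
    |>.exists_bound_of_continuousOn
      (hF.continuousOn (s := Set.Icc a b ×ˢ Set.Icc 0 M ×ˢ Set.Icc a b)))
  refine Integrable.of_bound (C := C) ?_ (Eventually.of_forall fun ω => ?_)
  · exact (hφ.mul (hF.measurable.comp ((h.delay_measurable i).prodMk
      ((h.wait_measurable j).prodMk (h.delay_measurable k))))).aestronglyMeasurable
  · rw [norm_mul]
    have h1 := hC (Y i ω, Z j ω, Y k ω) ⟨h.delay_mem i ω, h.wait_mem j ω, h.delay_mem k ω⟩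
    calc ‖φ ω‖ * ‖F (Y i ω, Z j ω, Y k ω)‖ ≤ 1 * C :=
          mul_le_mul (hφ1 ω) h1 (norm_nonneg _) zero_le_one
      _ = C := one_mul C

/-- Averaging over the delay of the next update, under a weight known when the cycle starts. -/
lemma integral_weight_mul (h : RegularSystem μ ν r a b M Y Q Z) (j n : ℕ) {φ : ℝ × ℝ → ℝ}
    (hφ : Measurable φ) (hφ1 : ∀ p, |φ p| ≤ 1) {F : ℝ × ℝ × ℝ → ℝ} (hF : Continuous F) :
    ∫ ω, φ (delivery Y Z j ω, Q n ω) * F (Y j ω, Z j ω, Y (j + 1) ω) ∂μ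
      = ∫ ω, φ (delivery Y Z j ω, Q n ω) * (∫ y, F (Y j ω, Z j ω, y) ∂ν) ∂μ := by
  have hUm : Measurable fun ω => ((delivery Y Z j ω, Q n ω), (Y j ω, Z j ω)) :=
    ((h.measurable_delivery j).prodMk (h.poisson.measurable n)).prodMk
      ((h.delay_measurable j).prodMk (h.wait_measurable j))
  have key := integral_indepFun (μ := μ) (h.delay_measurable (j + 1)) hUm
    (h.delay_law (j + 1)) (h.indepFun_delay_succ j n)
    (F := fun p y => φ p.1 * F (p.2.1, p.2.2, y)) (by
      refine (hφ.comp (measurable_fst.comp measurable_fst)).mul (hF.measurable.comp ?_)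
      fun_prop)
    (h.integrable_weight_mul (hφ.comp ((h.measurable_delivery j).prodMk (h.poisson.measurable n)))
      (fun ω => hφ1 _) hF j j (j + 1))
  rw [key]
  simp only [integral_const_mul]

lemma continuous_meanCyclePenalty (h : RegularSystem μ ν r a b M Y Q Z) (hg : Continuous g)
    (hmono : Monotone g) (v : ℝ) :
    Continuous fun p : ℝ × ℝ => meanCyclePenalty ν g v p.1 p.2 := by
  have := h.isProbabilityMeasure_law
  exact PullOrWait.continuous_meanCyclePenalty h.ae_law_mem hg hmono v

lemma continuous_optimalPenalty (h : RegularSystem μ ν r a b M Y Q Z) (hg : Continuous g)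
    (hmono : Monotone g) (v x : ℝ) :
    Continuous fun y : ℝ => meanCyclePenalty ν g v y (thresholdWait M x y) :=
  (h.continuous_meanCyclePenalty hg hmono v).comp (continuous_id.prodMk
    ((continuous_thresholdWait M).comp (continuous_const.prodMk continuous_id)))

lemma continuous_cycleLoss (h : RegularSystem μ ν r a b M Y Q Z) (hg : Continuous g)
    (hmono : Monotone g) (v x : ℝ) :
    Continuous fun p : ℝ × ℝ => cycleLoss ν g v M x p.1 p.2 :=
  (h.continuous_meanCyclePenalty hg hmono v).sub
    ((h.continuous_optimalPenalty hg hmono v x).comp continuous_fst)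

lemma integrable_weight_cycleLoss (h : RegularSystem μ ν r a b M Y Q Z) (hg : Continuous g)
    (hmono : Monotone g) (v x : ℝ) {φ : Ω → ℝ} (hφ : Measurable φ) (hφ1 : ∀ ω, |φ ω| ≤ 1) (j : ℕ) :
    Integrable (fun ω => φ ω * cycleLoss ν g v M x (Y j ω) (Z j ω)) μ :=
  h.integrable_weight_mul hφ hφ1 (F := fun p => cycleLoss ν g v M x p.1 p.2.1)
    ((h.continuous_cycleLoss hg hmono v x).comp
      (continuous_fst.prodMk (continuous_fst.comp continuous_snd))) j j j

lemma integrable_cycleLoss (h : RegularSystem μ ν r a b M Y Q Z) (hg : Continuous g)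
    (hmono : Monotone g) (v x : ℝ) (j : ℕ) :
    Integrable (fun ω => cycleLoss ν g v M x (Y j ω) (Z j ω)) μ := by
  simpa using h.integrable_weight_cycleLoss hg hmono v x (φ := fun _ => 1) measurable_const
    (by simp) j

lemma exists_cycleLoss_le (h : RegularSystem μ ν r a b M Y Q Z) (hg : Continuous g)
    (hmono : Monotone g) (v x : ℝ) :
    ∃ C, 0 ≤ C ∧ ∀ j ω, cycleLoss ν g v M x (Y j ω) (Z j ω) ≤ C := by
  obtain ⟨C, hC⟩ := (isCompact_Icc.prod isCompact_Icc).exists_bound_of_continuousOn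
    ((h.continuous_cycleLoss hg hmono v x).continuousOn (s := Set.Icc a b ×ˢ Set.Icc 0 M))
  exact ⟨max C 0, le_max_right _ _, fun j ω => (le_abs_self _).trans
    ((hC (Y j ω, Z j ω) ⟨h.delay_mem j ω, h.wait_mem j ω⟩).trans (le_max_left _ _))⟩

lemma exists_cumulativeLoss_le (h : RegularSystem μ ν r a b M Y Q Z) (hg : Continuous g)
    (hmono : Monotone g) (v x : ℝ) :
    ∃ C, 0 ≤ C ∧ ∀ n, cumulativeLoss μ ν g v M x Y Z n ≤ C * n := by
  obtain ⟨C, hC0, hC⟩ := h.exists_cycleLoss_le hg hmono v x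
  refine ⟨C, hC0, fun n => ?_⟩
  have : ∀ j ∈ Finset.range n, ∫ ω, cycleLoss ν g v M x (Y j ω) (Z j ω) ∂μ ≤ C := fun j _ => by
    have := integral_mono (h.integrable_cycleLoss hg hmono v x j) (integrable_const C)
      (hC j)
    simpa using this
  refine (Finset.sum_le_card_nsmul _ _ _ this).trans_eq ?_
  simp [mul_comm]

/-- The weighted mean excess penalty of a cycle splits into the loss and the optimal penalty. -/
lemma integral_weight_cyclePenalty (h : RegularSystem μ ν r a b M Y Q Z) (hg : Continuous g)
    (hmono : Monotone g) (v x : ℝ) (j n : ℕ) {φ : ℝ × ℝ → ℝ} (hφ : Measurable φ)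
    (hφ1 : ∀ p, |φ p| ≤ 1) :
    ∫ ω, φ (delivery Y Z j ω, Q n ω) * cyclePenalty g v (Y j ω) (Z j ω) (Y (j + 1) ω) ∂μ
      = (∫ ω, φ (delivery Y Z j ω, Q n ω) * cycleLoss ν g v M x (Y j ω) (Z j ω) ∂μ)
        + ∫ ω, φ (delivery Y Z j ω, Q n ω)
            * meanCyclePenalty ν g v (Y j ω) (thresholdWait M x (Y j ω)) ∂μ := by
  have hφm : Measurable fun ω => φ (delivery Y Z j ω, Q n ω) :=
    hφ.comp ((h.measurable_delivery j).prodMk (h.poisson.measurable n))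
  rw [h.integral_weight_mul j n hφ hφ1 (continuous_cyclePenalty hg v), ← integral_add
    (h.integrable_weight_cycleLoss hg hmono v x hφm (fun ω => hφ1 _) j)
    (h.integrable_weight_mul hφm (fun ω => hφ1 _)
      (F := fun p => meanCyclePenalty ν g v p.1 (thresholdWait M x p.1))
      ((h.continuous_optimalPenalty hg hmono v x).comp continuous_fst) j j j)]
  refine integral_congr_ae (Eventually.of_forall fun ω => ?_)
  simp only [cycleLoss, ← mul_add, sub_add_cancel]
  rfl

/-- The weight is independent of `Y (j + 1)`, and the optimal penalty of a fresh delay has mean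
zero. -/
lemma integral_weight_optimalPenalty_succ (h : RegularSystem μ ν r a b M Y Q Z)
    (hg : Continuous g) (hmono : Monotone g) (ho : IsOptimalThreshold ν g a b M v x) (j n : ℕ)
    {φ : ℝ × ℝ → ℝ} (hφ : Measurable φ) (hφ1 : ∀ p, |φ p| ≤ 1) :
    ∫ ω, φ (delivery Y Z j ω, Q n ω)
      * meanCyclePenalty ν g v (Y (j + 1) ω) (thresholdWait M x (Y (j + 1) ω)) ∂μ = 0 := by
  have := h.integral_weight_mul j n hφ hφ1
    (F := fun p => meanCyclePenalty ν g v p.2.2 (thresholdWait M x p.2.2))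
    ((h.continuous_optimalPenalty hg hmono v x).comp (by fun_prop))
  simp only [ho.integral_eq_zero, mul_zero, integral_zero] at this
  exact this

lemma integral_optimalPenalty (h : RegularSystem μ ν r a b M Y Q Z) (hg : Continuous g)
    (hmono : Monotone g) (ho : IsOptimalThreshold ν g a b M v x) (j : ℕ) :
    ∫ ω, meanCyclePenalty ν g v (Y j ω) (thresholdWait M x (Y j ω)) ∂μ = 0 := by
  rw [← ho.integral_eq_zero, ← h.delay_law j, integral_map (h.delay_measurable j).aemeasurable]
  rw [h.delay_law j]
  exact (h.continuous_optimalPenalty hg hmono v x).aestronglyMeasurable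

lemma integrable_delivery (h : RegularSystem μ ν r a b M Y Q Z) (n : ℕ) :
    Integrable (delivery Y Z n) μ :=
  Integrable.of_bound (h.measurable_delivery n).aestronglyMeasurable (n * (M + b))
    (Eventually.of_forall fun ω => by
      rw [Real.norm_eq_abs, abs_of_nonneg (h.delivery_nonneg n ω)]
      exact delivery_le_mul (h.delay_mem · ω) (h.wait_mem · ω) n)

lemma integral_sub_const (h : RegularSystem μ ν r a b M Y Q Z) (hg : Continuous g) (v : ℝ)
    {w : Ω → ℝ} (hw : Measurable w) (hw0 : ∀ ω, 0 ≤ w ω) (hwi : Integrable w μ) :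
    ∫ ω, (∫ t in (0 : ℝ)..w ω, g (age Y Z ω t)) ∂μ
      = (∫ ω, (∫ t in (0 : ℝ)..w ω, (g (age Y Z ω t) - v)) ∂μ) + v * ∫ ω, w ω ∂μ := by
  rw [← integral_const_mul, ← integral_add (h.integrable_integral_age
    (f := fun y => g y - v) (hg.sub continuous_const) measurable_const hw (fun _ => le_rfl) hw0
    (integrable_const _) hwi) (hwi.const_mul v)]
  refine integral_congr_ae (Eventually.of_forall fun ω => ?_)
  simp only
  rw [intervalIntegral.integral_sub (intervalIntegrable_age h.lower_pos (h.delay_mem · ω)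
    (h.wait_mem · ω) hg le_rfl (hw0 ω)) intervalIntegrable_const, intervalIntegral.integral_const]
  simp only [smul_eq_mul]
  ring

/-- The mean penalty collected before the `n`-th delivery. -/
theorem integral_delivery_eq (h : RegularSystem μ ν r a b M Y Q Z) (hg : Continuous g)
    (hmono : Monotone g) (ho : IsOptimalThreshold ν g a b M v x) (n : ℕ) :
    ∫ ω, (∫ t in (0 : ℝ)..delivery Y Z n ω, g (age Y Z ω t)) ∂μ
      = cumulativeLoss μ ν g v M x Y Z n + v * ∫ ω, delivery Y Z n ω ∂μ := by
  rw [h.integral_sub_const hg v (h.measurable_delivery n) (h.delivery_nonneg n)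
    (h.integrable_delivery n)]
  congr 1
  have e : ∀ ω, ∫ t in (0 : ℝ)..delivery Y Z n ω, (g (age Y Z ω t) - v)
      = ∑ j ∈ Finset.range n, cyclePenalty g v (Y j ω) (Z j ω) (Y (j + 1) ω) := fun ω =>
    integral_delivery_sub h.lower_pos (h.delay_mem · ω) (h.wait_mem · ω) hg v n
  simp_rw [e]
  rw [integral_finsetSum _ fun j _ => by
    simpa using h.integrable_weight_mul (φ := fun _ => 1) measurable_const (by simp)
      (continuous_cyclePenalty hg v) j j (j + 1)]
  refine Finset.sum_congr rfl fun j _ => ?_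
  have := h.integral_weight_cyclePenalty hg hmono v x j 0 (φ := fun _ => 1) measurable_const
    (by simp)
  simpa [h.integral_optimalPenalty hg hmono ho] using this

/-- The indicator of `p.1 ≤ p.2`, applied to a delivery time and a query time. -/
noncomputable def weight : ℝ × ℝ → ℝ := fun p => if p.1 ≤ p.2 then 1 else 0

lemma measurable_weight : Measurable weight :=
  Measurable.ite (measurableSet_le measurable_fst measurable_snd) measurable_const measurable_const

lemma abs_weight_le (p : ℝ × ℝ) : |weight p| ≤ 1 := by
  unfold weight; split_ifs <;> simp

lemma weight_mul (s t c : ℝ) : weight (s, t) * c = if s ≤ t then c else 0 := by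
  simp [weight]

lemma abs_integral_sub_integral_le {f₁ f₂ : Ω → ℝ} {C : ℝ} (h₁ : Integrable f₁ μ)
    (h₂ : Integrable f₂ μ) (hC : ∀ ω, |f₁ ω - f₂ ω| ≤ C) :
    |(∫ ω, f₁ ω ∂μ) - ∫ ω, f₂ ω ∂μ| ≤ C := by
  rw [← integral_sub h₁ h₂]
  simpa using norm_integral_le_of_norm_le_const (μ := μ) (f := fun ω => f₁ ω - f₂ ω)
    (Eventually.of_forall hC)

/-- The event `D j ≤ Q n` involves `Y j`, so the individual terms need not vanish. Testing `D (j -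
1) ≤ Q n` instead makes them vanish, and on each path this changes at most one term of the sum. -/
lemma abs_sum_weight_optimalPenalty_le (h : RegularSystem μ ν r a b M Y Q Z) (hg : Continuous g)
    (hmono : Monotone g) (ho : IsOptimalThreshold ν g a b M v x) {C : ℝ}
    (hC : ∀ y ∈ Set.Icc a b, |meanCyclePenalty ν g v y (thresholdWait M x y)| ≤ C) (n N : ℕ) :
    |∑ j ∈ Finset.range N, ∫ ω, weight (delivery Y Z j ω, Q n ω)
        * meanCyclePenalty ν g v (Y j ω) (thresholdWait M x (Y j ω)) ∂μ| ≤ C := by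
  have hwm : ∀ j, Measurable fun ω => weight (delivery Y Z j ω, Q n ω) := fun j =>
    measurable_weight.comp ((h.measurable_delivery j).prodMk (h.poisson.measurable n))
  have hC0 : 0 ≤ C := by
    obtain ⟨ω⟩ := nonempty_of_isProbabilityMeasure μ
    exact (abs_nonneg _).trans (hC _ (h.delay_mem 0 ω))
  rcases N with _ | N
  · simpa using hC0
  have h_int : ∀ i j, Integrable (fun ω => weight (delivery Y Z i ω, Q n ω)
      * meanCyclePenalty ν g v (Y j ω) (thresholdWait M x (Y j ω))) μ := fun i j =>
    h.integrable_weight_mul (hwm i) (fun _ => abs_weight_le _)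
      (F := fun p => meanCyclePenalty ν g v p.1 (thresholdWait M x p.1))
      ((h.continuous_optimalPenalty hg hmono v x).comp continuous_fst) j j j
  -- The first cycle has no predecessor, but `D 0 = 0 ≤ Q n` always, so its weight is `1`.
  have h0 : ∫ ω, weight (delivery Y Z 0 ω, Q n ω)
      * meanCyclePenalty ν g v (Y 0 ω) (thresholdWait M x (Y 0 ω)) ∂μ = 0 := by
    rw [← h.integral_optimalPenalty hg hmono ho 0]
    refine integral_congr_ae (Eventually.of_forall fun ω => ?_)
    simp only
    rw [weight_mul, if_pos (show delivery Y Z 0 ω ≤ Q n ω from h.query_nonneg n ω)]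
  rw [Finset.sum_range_succ', h0, add_zero]
  have h1 : ∑ j ∈ Finset.range N, ∫ ω, weight (delivery Y Z j ω, Q n ω)
      * meanCyclePenalty ν g v (Y (j + 1) ω) (thresholdWait M x (Y (j + 1) ω)) ∂μ = 0 :=
    Finset.sum_eq_zero fun j _ =>
      h.integral_weight_optimalPenalty_succ hg hmono ho j n measurable_weight abs_weight_le
  rw [← sub_zero (∑ j ∈ Finset.range N, _), ← h1, ← integral_finsetSum _ fun j _ => h_int _ _,
    ← integral_finsetSum _ fun j _ => h_int _ _]
  refine abs_integral_sub_integral_le (integrable_finsetSum _ fun j _ => h_int _ _)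
    (integrable_finsetSum _ fun j _ => h_int _ _) fun ω => ?_
  simp only [weight_mul]
  refine (abs_sum_delivery_shift_le h.lower_pos (h.delay_mem · ω) (h.wait_mem · ω)
    (m := fun y => meanCyclePenalty ν g v y (thresholdWait M x y)) hC N).trans ?_
  split_ifs <;> simp [hC0]

/-- The mean excess penalty before `Q n` is, up to a constant, the expected loss in the cycles that
start before `Q n`. -/
lemma exists_abs_integral_query_sub_le (h : RegularSystem μ ν r a b M Y Q Z) (hg : Continuous g)
    (hmono : Monotone g) (ho : IsOptimalThreshold ν g a b M v x) :
    ∃ C, ∀ n N : ℕ, 0 < n → 2 * (n / r) ≤ N * a →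
      |(∫ ω, (∫ t in (0 : ℝ)..Q n ω, (g (age Y Z ω t) - v)) ∂μ)
        - ∑ j ∈ Finset.range N, ∫ ω, weight (delivery Y Z j ω, Q n ω)
          * cycleLoss ν g v M x (Y j ω) (Z j ω) ∂μ| ≤ C := by
  have hgv : Continuous fun y => g y - v := hg.sub continuous_const
  obtain ⟨C₁, hC₁⟩ := isCompact_Icc.exists_bound_of_continuousOn
    (hgv.continuousOn (s := Set.Icc 0 (M + 2 * b)))
  obtain ⟨C₂, hC₂⟩ := isCompact_Icc.exists_bound_of_continuousOn
    ((h.continuous_optimalPenalty hg hmono v x).continuousOn (s := Set.Icc a b))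
  simp only [Real.norm_eq_abs] at hC₁ hC₂
  obtain ⟨ω₀⟩ := nonempty_of_isProbabilityMeasure μ
  have hab : a ≤ b := (h.delay_mem 0 ω₀).1.trans (h.delay_mem 0 ω₀).2
  have ha := h.lower_pos
  have hM := h.wait_bound_nonneg
  have hC₁0 : 0 ≤ C₁ := (abs_nonneg _).trans (hC₁ 0 ⟨le_rfl, by linarith⟩)
  have hr := h.poisson.rate_pos
  refine ⟨C₁ * (1 / (4 * r)) + (C₁ * (M + b) + C₂), fun n N hn hN => ?_⟩
  have hQm := h.poisson.measurable n
  have hDm := h.measurable_delivery N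
  have hmin0 : ∀ ω, 0 ≤ min (Q n ω) (delivery Y Z N ω) := fun ω =>
    le_min (h.query_nonneg n ω) (h.delivery_nonneg N ω)
  have hint1 := h.integrable_integral_age hgv measurable_const hQm (fun _ => le_rfl)
    (h.query_nonneg n) (integrable_const _) (h.poisson.integrable n)
  have hint2 := h.integrable_integral_age hgv measurable_const (hQm.min hDm) (fun _ => le_rfl)
    hmin0 (integrable_const _) ((h.poisson.integrable n).inf (h.integrable_delivery N))
  have hwm : ∀ j, Measurable fun ω => weight (delivery Y Z j ω, Q n ω) := fun j =>
    measurable_weight.comp ((h.measurable_delivery j).prodMk hQm)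
  have hint3 : ∀ j ∈ Finset.range N, Integrable (fun ω => weight (delivery Y Z j ω, Q n ω)
      * cyclePenalty g v (Y j ω) (Z j ω) (Y (j + 1) ω)) μ := fun j _ =>
    h.integrable_weight_mul (hwm j) (fun _ => abs_weight_le _) (continuous_cyclePenalty hg v)
      j j (j + 1)
  -- Stop at `D N` as well. Since `D N ≥ N * a ≥ 2 * (n / r)`, the part cut off is at most the
  -- excess of `Q n` over twice its mean.
  have step1 : |(∫ ω, (∫ t in (0 : ℝ)..Q n ω, (g (age Y Z ω t) - v)) ∂μ)
      - ∫ ω, (∫ t in (0 : ℝ)..min (Q n ω) (delivery Y Z N ω), (g (age Y Z ω t) - v)) ∂μ|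
      ≤ C₁ * (1 / (4 * r)) := by
    rw [← integral_sub hint1 hint2]
    refine (abs_integral_le_integral_abs).trans ?_
    refine le_trans (integral_mono (g := fun ω => C₁ * max (Q n ω - 2 * (n / r)) 0)
      (hint1.sub hint2).abs ((h.poisson.integrable_posPart n _).const_mul _) fun ω => ?_) ?_
    · have hi : ∀ {s t : ℝ}, 0 ≤ s → 0 ≤ t →
          IntervalIntegrable (fun t => g (age Y Z ω t) - v) volume s t := fun hs ht =>
        intervalIntegrable_age h.lower_pos (h.delay_mem · ω) (h.wait_mem · ω) hgv hs ht
      simp only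
      rw [intervalIntegral.integral_interval_sub_left (hi le_rfl (h.query_nonneg n ω))
        (hi le_rfl (hmin0 ω))]
      refine (h.abs_integral_age_le (f := fun y => g y - v) hC₁ (hmin0 ω)
        (h.query_nonneg n ω) ω).trans (mul_le_mul_of_nonneg_left ?_ hC₁0)
      rw [abs_of_nonneg (by linarith [min_le_left (Q n ω) (delivery Y Z N ω)])]
      rcases le_total (Q n ω) (delivery Y Z N ω) with hle | hle
      · rw [min_eq_left hle, sub_self]; exact le_max_right _ _
      · rw [min_eq_right hle]
        refine le_trans ?_ (le_max_left _ _)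
        linarith [mul_le_delivery (h.delay_mem · ω) (h.wait_mem · ω) N]
    · rw [integral_const_mul]
      exact mul_le_mul_of_nonneg_left (h.poisson.integral_posPart_le hn) hC₁0
  -- Only the cycle that `Q n` interrupts is counted differently, and it is no longer than `M + b`.
  have step2 : |(∫ ω, (∫ t in (0 : ℝ)..min (Q n ω) (delivery Y Z N ω), (g (age Y Z ω t) - v)) ∂μ)
      - ∑ j ∈ Finset.range N, ∫ ω, weight (delivery Y Z j ω, Q n ω)
        * cyclePenalty g v (Y j ω) (Z j ω) (Y (j + 1) ω) ∂μ| ≤ C₁ * (M + b) := by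
    rw [← integral_finsetSum _ hint3]
    refine abs_integral_sub_integral_le hint2 (integrable_finsetSum _ hint3) fun ω => ?_
    simp only [weight_mul]
    refine (abs_integral_min_sub_sum_le h.lower_pos (h.delay_mem · ω) (h.wait_mem · ω) hg
      (h.query_nonneg n ω) hC₁ N).trans ?_
    split_ifs
    · exact mul_nonneg hC₁0 (by linarith)
    · exact le_rfl
  have step3 := h.abs_sum_weight_optimalPenalty_le hg hmono ho hC₂ n N
  have split : ∑ j ∈ Finset.range N, ∫ ω, weight (delivery Y Z j ω, Q n ω)
        * cyclePenalty g v (Y j ω) (Z j ω) (Y (j + 1) ω) ∂μ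
      = (∑ j ∈ Finset.range N, ∫ ω, weight (delivery Y Z j ω, Q n ω)
          * cycleLoss ν g v M x (Y j ω) (Z j ω) ∂μ)
        + ∑ j ∈ Finset.range N, ∫ ω, weight (delivery Y Z j ω, Q n ω)
          * meanCyclePenalty ν g v (Y j ω) (thresholdWait M x (Y j ω)) ∂μ := by
    rw [← Finset.sum_add_distrib]
    exact Finset.sum_congr rfl fun j _ =>
      h.integral_weight_cyclePenalty hg hmono v x j n measurable_weight abs_weight_le
  rw [split] at step2
  rw [abs_le] at *
  constructor <;> linarith [step1.1, step1.2, step2.1, step2.2, step3.1, step3.2]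

/-- The mean excess penalty before `Q n` is bounded above and below by the expected losses in
numbers of cycles proportional to `n`. -/
theorem exists_bounds_integral_query (h : RegularSystem μ ν r a b M Y Q Z) (hg : Continuous g)
    (hmono : Monotone g) (ho : IsOptimalThreshold ν g a b M v x) :
    ∃ C, (∀ n N : ℕ, 0 < n → 2 * (n / r) ≤ N * a →
        ∫ ω, (∫ t in (0 : ℝ)..Q n ω, (g (age Y Z ω t) - v)) ∂μ
          ≤ cumulativeLoss μ ν g v M x Y Z N + C) ∧
      ∀ n K : ℕ, 0 < n → K * (M + b) ≤ n / r / 2 →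
        cumulativeLoss μ ν g v M x Y Z K - C
          ≤ ∫ ω, (∫ t in (0 : ℝ)..Q n ω, (g (age Y Z ω t) - v)) ∂μ := by
  obtain ⟨C₁, hC₁⟩ := h.exists_abs_integral_query_sub_le hg hmono ho
  obtain ⟨C₂, hC₂0, hC₂⟩ := h.exists_cycleLoss_le hg hmono v x
  obtain ⟨ω₀⟩ := nonempty_of_isProbabilityMeasure μ
  have hab : a ≤ b := (h.delay_mem 0 ω₀).1.trans (h.delay_mem 0 ω₀).2
  have ha := h.lower_pos
  have hM := h.wait_bound_nonneg
  have hr := h.poisson.rate_pos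
  have hMb : 0 < M + b := by linarith
  have hwm : ∀ n j, Measurable fun ω => weight (delivery Y Z j ω, Q n ω) := fun n j =>
    measurable_weight.comp ((h.measurable_delivery j).prodMk (h.poisson.measurable n))
  have h_int : ∀ n j, Integrable (fun ω => weight (delivery Y Z j ω, Q n ω)
      * cycleLoss ν g v M x (Y j ω) (Z j ω)) μ := fun n j =>
    h.integrable_weight_cycleLoss hg hmono v x (hwm n j) (fun _ => abs_weight_le _) j
  have h_int' := h.integrable_cycleLoss hg hmono v x
  have hC' : 0 ≤ 2 * C₂ / (r * (M + b)) := by positivity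
  refine ⟨C₁ + 2 * C₂ / (r * (M + b)), fun n N hn hN => ?_, fun n K hn hK => ?_⟩
  · have h1 := (abs_le.mp (hC₁ n N hn hN)).2
    -- Losses are nonnegative, so replacing the weights by `1` can only increase the sum.
    have h2 : ∑ j ∈ Finset.range N, ∫ ω, weight (delivery Y Z j ω, Q n ω)
        * cycleLoss ν g v M x (Y j ω) (Z j ω) ∂μ ≤ cumulativeLoss μ ν g v M x Y Z N := by
      refine Finset.sum_le_sum fun j _ => integral_mono (h_int n j) (h_int' j) fun ω => ?_
      simp only [weight_mul]
      split_ifs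
      · exact le_rfl
      · exact h.cycleLoss_nonneg ho j ω
    linarith
  · have hn' : (0 : ℝ) < n := by exact_mod_cast hn
    -- The comparison needs many cycles and the lower bound only `K` of them; `max N₀ K` serves
    -- both, and the surplus terms are nonnegative.
    obtain ⟨N₀, hN₀⟩ := exists_nat_ge (2 * (n / r) / a)
    have hN : 2 * (n / r) ≤ (max N₀ K : ℕ) * a := by
      rw [div_le_iff₀ ha] at hN₀
      exact hN₀.trans (mul_le_mul_of_nonneg_right (by exact_mod_cast le_max_left _ _) ha.le)
    have h1 := (abs_le.mp (hC₁ n _ hn hN)).1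
    have h2 : ∑ j ∈ Finset.range K, ∫ ω, weight (delivery Y Z j ω, Q n ω)
          * cycleLoss ν g v M x (Y j ω) (Z j ω) ∂μ
        ≤ ∑ j ∈ Finset.range (max N₀ K), ∫ ω, weight (delivery Y Z j ω, Q n ω)
          * cycleLoss ν g v M x (Y j ω) (Z j ω) ∂μ := by
      refine Finset.sum_le_sum_of_subset_of_nonneg
        (Finset.range_mono (le_max_right _ _)) fun j _ _ => integral_nonneg fun ω => ?_
      simp only [weight_mul, Pi.zero_apply]
      split_ifs
      · exact h.cycleLoss_nonneg ho j ω
      · exact le_rfl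
    have hs : MeasurableSet {ω | Q n ω < n / r / 2} :=
      measurableSet_lt (h.poisson.measurable n) measurable_const
    -- For `j < K` the delivery time is at most `K * (M + b) ≤ n / r / 2`, so the weight can vanish
    -- only on the rare event `Q n < n / r / 2`.
    have h3 : ∀ j ∈ Finset.range K, ∫ ω, cycleLoss ν g v M x (Y j ω) (Z j ω) ∂μ
        ≤ (∫ ω, weight (delivery Y Z j ω, Q n ω)
          * cycleLoss ν g v M x (Y j ω) (Z j ω) ∂μ) + C₂ * (4 / n) := by
      intro j hj
      have hp := h.poisson.prob_lt_le hn
      rw [← integral_indicator_one hs] at hp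
      refine le_trans ?_ (add_le_add_right (mul_le_mul_of_nonneg_left hp hC₂0) _)
      have hi1 : Integrable ({ω | Q n ω < n / r / 2}.indicator (1 : Ω → ℝ)) μ :=
        (integrable_const (1 : ℝ)).indicator hs
      rw [← integral_const_mul, ← integral_add (h_int n j) (hi1.const_mul _)]
      refine integral_mono (h_int' j) ((h_int n j).add (hi1.const_mul _)) fun ω => ?_
      simp only [weight_mul]
      split_ifs with hd
      · refine le_add_of_nonneg_right (mul_nonneg hC₂0 (Set.indicator_nonneg ?_ ω))
        exact fun _ _ => zero_le_one
      · have hjK : (j : ℝ) ≤ K := by exact_mod_cast (Finset.mem_range.mp hj).le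
        have : ω ∈ {ω | Q n ω < n / r / 2} :=
          (not_le.mp hd).trans_le ((delivery_le_mul (h.delay_mem · ω) (h.wait_mem · ω) j).trans
            ((mul_le_mul_of_nonneg_right hjK hMb.le).trans hK))
        rw [Set.indicator_of_mem this]
        simpa using hC₂ j ω
    have h4 : cumulativeLoss μ ν g v M x Y Z K
        ≤ (∑ j ∈ Finset.range K, ∫ ω, weight (delivery Y Z j ω, Q n ω)
          * cycleLoss ν g v M x (Y j ω) (Z j ω) ∂μ) + K * (C₂ * (4 / n)) := by
      refine (Finset.sum_le_sum h3).trans_eq ?_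
      rw [Finset.sum_add_distrib]
      simp
    -- There are at most of order `n` cycles, each with error of order `1 / n`.
    have h5 : K * (C₂ * (4 / n)) ≤ 2 * C₂ / (r * (M + b)) := by
      rw [le_div_iff₀ (by positivity)]
      calc K * (C₂ * (4 / n)) * (r * (M + b)) = (K * (M + b)) * (C₂ * (4 / n) * r) := by ring
        _ ≤ (n / r / 2) * (C₂ * (4 / n) * r) := mul_le_mul_of_nonneg_right hK (by positivity)
        _ = 2 * C₂ := by field_simp; ring
    linarith

end RegularSystem

/-! ### Independence and decision rules -/

section Independence

variable {Ω : Type*} [MeasurableSpace Ω] {μ : Measure Ω} [IsProbabilityMeasure μ]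
  {α β γ : Type*} [MeasurableSpace α] [MeasurableSpace β] [MeasurableSpace γ]

/-- The joint law of the triple is the product of the three marginals; reassociating the product
moves `B` to the other side. -/
lemma indepFun_prodMk_of_indepFun {A : Ω → α} {B : Ω → β} {C : Ω → γ} (hA : Measurable A)
    (hB : Measurable B) (hC : Measurable C) (hAB : IndepFun A B μ)
    (hABC : IndepFun (fun ω => (A ω, B ω)) C μ) : IndepFun A (fun ω => (B ω, C ω)) μ := by
  have hBC : IndepFun B C μ := hABC.comp (φ := Prod.snd) (ψ := id) measurable_snd measurable_id
  have := Measure.isProbabilityMeasure_map (μ := μ) hA.aemeasurable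
  have := Measure.isProbabilityMeasure_map (μ := μ) hB.aemeasurable
  have := Measure.isProbabilityMeasure_map (μ := μ) hC.aemeasurable
  rw [indepFun_iff_map_prod_eq_prod_map_map hA.aemeasurable (hB.prodMk hC).aemeasurable,
    hBC.map_prod_eq_prod_map_map hB.aemeasurable hC.aemeasurable,
    ← (measurePreserving_prodAssoc (μ.map A) (μ.map B) (μ.map C)).map_eq,
    ← hAB.map_prod_eq_prod_map_map hA.aemeasurable hB.aemeasurable,
    ← hABC.map_prod_eq_prod_map_map (hA.prodMk hB).aemeasurable hC.aemeasurable,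
    Measure.map_map MeasurableEquiv.prodAssoc.measurable ((hA.prodMk hB).prodMk hC)]
  rfl

end Independence

section Policies

variable {Ω 𝓦 : Type*}

lemma delivery_congr {Y Z Y' Z' : ℕ → Ω → ℝ} {ω : Ω} {j : ℕ} (hY : ∀ i, Y i ω = Y' i ω)
    (hZ : ∀ i < j, Z i ω = Z' i ω) : delivery Y Z j ω = delivery Y' Z' j ω := by
  induction j with
  | zero => rfl
  | succ j ih =>
    rw [delivery_succ, delivery_succ, ih fun i hi => hZ i (by omega), hZ j (by omega), hY]

/-- The waiting periods produced by the decision rules `f` when the queries are observed through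
`o`: `o ω d` is what is known about the queries at time `d`. -/
noncomputable def runPolicy (f : ∀ j : ℕ, 𝓦 × (Fin (j + 1) → ℝ) × (Fin j → ℝ) × (ℕ → ℝ) → ℝ)
    (W : Ω → 𝓦) (Y : ℕ → Ω → ℝ) (o : Ω → ℝ → ℕ → ℝ) (j : ℕ) (ω : Ω) : ℝ :=
  f j (W ω, fun i => Y i ω, fun i => runPolicy f W Y o i ω,
    o ω (delivery Y (fun i _ => if _h : i < j then runPolicy f W Y o i ω else 0) j ω))
termination_by j
decreasing_by
  · exact i.2
  · assumption

/-- The cutoff in the definition only makes the recursion well founded: `D j` uses no waiting period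
of index `j` or more. -/
lemma runPolicy_eq (f : ∀ j : ℕ, 𝓦 × (Fin (j + 1) → ℝ) × (Fin j → ℝ) × (ℕ → ℝ) → ℝ)
    (W : Ω → 𝓦) (Y : ℕ → Ω → ℝ) (o : Ω → ℝ → ℕ → ℝ) (j : ℕ) (ω : Ω) :
    runPolicy f W Y o j ω = f j (W ω, fun i => Y i ω, fun i => runPolicy f W Y o i ω,
      o ω (delivery Y (runPolicy f W Y o) j ω)) := by
  rw [runPolicy, delivery_congr (Y' := Y) (Z' := runPolicy f W Y o) (fun _ => rfl)]
  intro i hi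
  rw [dif_pos hi]

lemma measurable_runPolicy [MeasurableSpace 𝓦] {m : MeasurableSpace Ω}
    {f : ∀ j : ℕ, 𝓦 × (Fin (j + 1) → ℝ) × (Fin j → ℝ) × (ℕ → ℝ) → ℝ}
    (hf : ∀ j, Measurable (f j)) {W : Ω → 𝓦} (hW : Measurable W) {Y : ℕ → Ω → ℝ}
    {o : Ω → ℝ → ℕ → ℝ} (ho : Measurable (Function.uncurry o)) (j : ℕ)
    (hY : ∀ i ≤ j, Measurable (Y i)) : Measurable (runPolicy f W Y o j) := by
  induction j using Nat.strong_induction_on with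
  | _ j ih =>
    have hZ : ∀ i < j, Measurable (runPolicy f W Y o i) := fun i hi =>
      ih i hi fun l hl => hY l (by omega)
    have e : runPolicy f W Y o j = fun ω => f j (W ω, fun i => Y i ω,
        fun i => runPolicy f W Y o i ω, o ω (delivery Y (runPolicy f W Y o) j ω)) :=
      funext fun ω => runPolicy_eq f W Y o j ω
    rw [e]
    have h1 : Measurable fun ω => fun i : Fin (j + 1) => Y i ω :=
      measurable_pi_lambda _ fun i => hY i (by omega)
    have h2 : Measurable fun ω => fun i : Fin j => runPolicy f W Y o i ω :=
      measurable_pi_lambda _ fun i => hZ i i.2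
    refine (hf j).comp (hW.prodMk (h1.prodMk (h2.prodMk ?_)))
    exact ho.comp (measurable_id.prodMk (measurable_delivery_of_le hY hZ))

/-- The queries before the present time. -/
def observe (Q : ℕ → Ω → ℝ) (ω : Ω) (d : ℝ) (i : ℕ) : ℝ := min (Q i ω) d

/-- The queries before the present time, as if there were none after `Q k`. -/
noncomputable def observeUpTo (k : ℕ) (Q : ℕ → Ω → ℝ) (ω : Ω) (d : ℝ) (i : ℕ) : ℝ :=
  if i ≤ k then min (Q i ω) d else d

lemma measurable_observe {m : MeasurableSpace Ω} {Q : ℕ → Ω → ℝ} (hQ : ∀ i, Measurable (Q i)) :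
    Measurable (Function.uncurry (observe Q)) :=
  measurable_pi_lambda _ fun i => ((hQ i).comp measurable_fst).min measurable_snd

lemma measurable_observeUpTo {m : MeasurableSpace Ω} {Q : ℕ → Ω → ℝ} {k : ℕ}
    (hQ : ∀ i ≤ k, Measurable (Q i)) : Measurable (Function.uncurry (observeUpTo k Q)) := by
  refine measurable_pi_lambda _ fun i => ?_
  by_cases hi : i ≤ k
  · simpa [observeUpTo, Function.uncurry_def, hi] using
      ((hQ i hi).comp measurable_fst).min (measurable_snd (β := ℝ))
  · simpa [observeUpTo, Function.uncurry_def, hi] using measurable_snd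

/-- Up to the query after `Q k`, the age does not depend on the queries after `Q k`. -/
lemma age_runPolicy_observeUpTo
    {f : ∀ j : ℕ, 𝓦 × (Fin (j + 1) → ℝ) × (Fin j → ℝ) × (ℕ → ℝ) → ℝ} (hf : ∀ j p, 0 ≤ f j p)
    (W : Ω → 𝓦) {Y Q : ℕ → Ω → ℝ} {ω : Ω} (hY : ∀ j, 0 ≤ Y j ω) (hQ : Monotone fun k => Q k ω)
    {k : ℕ} {t : ℝ} (ht : t ≤ Q (k + 1) ω) :
    age Y (runPolicy f W Y (observe Q)) ω t = age Y (runPolicy f W Y (observeUpTo k Q)) ω t := by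
  set Z := runPolicy f W Y (observe Q) with hZ
  set Z' := runPolicy f W Y (observeUpTo k Q) with hZ'
  have hZ0 : ∀ j, 0 ≤ Z j ω := fun j => by rw [hZ, runPolicy_eq]; exact hf _ _
  have hZ'0 : ∀ j, 0 ≤ Z' j ω := fun j => by rw [hZ', runPolicy_eq]; exact hf _ _
  -- The two runs make the same decisions until both have moved beyond `t`, after which their
  -- deliveries no longer affect the age at `t`.
  have key : ∀ j, (∀ i < j, Z i ω = Z' i ω) ∨ (t < delivery Y Z j ω ∧ t < delivery Y Z' j ω) := by
    intro j
    induction j with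
    | zero => exact Or.inl fun i hi => absurd hi (Nat.not_lt_zero i)
    | succ j ih =>
      rcases ih with ih | ⟨h1, h2⟩
      · have hD : delivery Y Z j ω = delivery Y Z' j ω := delivery_congr (fun _ => rfl) ih
        rcases le_or_gt (delivery Y Z j ω) t with hle | hlt
        · left
          intro i hi
          rcases Nat.lt_succ_iff_lt_or_eq.mp hi with hi | rfl
          · exact ih i hi
          · rw [hZ, hZ', runPolicy_eq, runPolicy_eq f W Y (observeUpTo k Q), ← hZ, ← hZ', ← hD]
            -- A decision taken at or before `t ≤ Q (k + 1)` sees every later query truncated to the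
            -- present, exactly as if it were hidden.
            have ho : observe Q ω (delivery Y Z i ω) = observeUpTo k Q ω (delivery Y Z i ω) := by
              ext l
              unfold observe observeUpTo
              split_ifs with hl
              · rfl
              · exact min_eq_right (hle.trans (ht.trans (hQ (by omega : k + 1 ≤ l))))
            have hz : (fun l : Fin i => Z l ω) = fun l : Fin i => Z' l ω :=
              funext fun l => ih l l.2
            rw [ho, hz]
        · right
          rw [delivery_succ, delivery_succ, ← hD]
          constructor <;> linarith [hZ0 j, hZ'0 j, hY (j + 1)]
      · right
        rw [delivery_succ, delivery_succ]
        constructor <;> linarith [hZ0 j, hZ'0 j, hY (j + 1)]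
  have hset : ∀ j x, (delivery Y Z j ω ≤ t ∧ x = request Y Z j ω)
      ↔ (delivery Y Z' j ω ≤ t ∧ x = request Y Z' j ω) := by
    intro j x
    rcases key j with h | ⟨h1, h2⟩
    · rw [request, request, delivery_congr (fun _ => rfl) h]
    · exact ⟨fun h => absurd h.1 (not_le.mpr h1), fun h => absurd h.1 (not_le.mpr h2)⟩
  simp only [age, hset]

end Policies

/-! ### Replacing almost sure hypotheses by sure ones -/

section Regularization

/-- The delays truncated to `[a, b]`. -/
noncomputable def clampedDelay {Ω : Type*} (a b : ℝ) (Y : ℕ → Ω → ℝ) (j : ℕ) (ω : Ω) : ℝ :=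
  max a (min b (Y j ω))

/-- The queries with negative gaps removed. -/
noncomputable def orderedQuery {Ω : Type*} (Q : ℕ → Ω → ℝ) (k : ℕ) (ω : Ω) : ℝ :=
  ∑ i ∈ Finset.range k, max 0 (Q (i + 1) ω - Q i ω)

variable {Ω 𝓦 : Type*}

lemma orderedQuery_gap (Q : ℕ → Ω → ℝ) (k : ℕ) (ω : Ω) :
    orderedQuery Q (k + 1) ω - orderedQuery Q k ω = max 0 (Q (k + 1) ω - Q k ω) := by
  simp [orderedQuery, Finset.sum_range_succ]

lemma monotone_orderedQuery (Q : ℕ → Ω → ℝ) (ω : Ω) : Monotone fun k => orderedQuery Q k ω :=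
  monotone_nat_of_le_succ fun k => by
    have := orderedQuery_gap Q k ω
    linarith [le_max_left 0 (Q (k + 1) ω - Q k ω)]

lemma clampedDelay_mem {a b : ℝ} (hab : a ≤ b) (Y : ℕ → Ω → ℝ) (j : ℕ) (ω : Ω) :
    clampedDelay a b Y j ω ∈ Set.Icc a b :=
  ⟨le_max_left _ _, max_le hab (min_le_left _ _)⟩

lemma clampedDelay_eq {a b : ℝ} {Y : ℕ → Ω → ℝ} {j : ℕ} {ω : Ω} (h : Y j ω ∈ Set.Icc a b) :
    clampedDelay a b Y j ω = Y j ω := by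
  rw [clampedDelay, min_eq_right h.2, max_eq_right h.1]

lemma measurable_prodMk_sequences {m : MeasurableSpace Ω} {Y Z : ℕ → Ω → ℝ} {X : Ω → ℝ}
    (hY : ∀ j, Measurable (Y j)) (hZ : ∀ j, Measurable (Z j)) (hX : Measurable X) :
    Measurable fun ω => ((fun j => Y j ω : ℕ → ℝ), (fun j => Z j ω : ℕ → ℝ), X ω) :=
  (measurable_pi_lambda _ hY).prodMk ((measurable_pi_lambda _ hZ).prodMk hX)

variable [mΩ : MeasurableSpace Ω] {μ : Measure Ω}

lemma IsPoissonArrivals.ae_gap_nonneg {r : ℝ} {Q : ℕ → Ω → ℝ} (hQ : IsPoissonArrivals μ r Q)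
    (k : ℕ) : ∀ᵐ ω ∂μ, 0 ≤ Q (k + 1) ω - Q k ω := by
  have h := ae_nonneg_expMeasure r
  rw [← (hQ.gap_law k).map_eq] at h
  exact ae_of_ae_map (hQ.gap_law k).aemeasurable h

lemma IsPoissonArrivals.ae_orderedQuery_eq {r : ℝ} {Q : ℕ → Ω → ℝ}
    (hQ : IsPoissonArrivals μ r Q) : ∀ᵐ ω ∂μ, ∀ k, orderedQuery Q k ω = Q k ω := by
  filter_upwards [ae_all_iff.mpr hQ.ae_gap_nonneg] with ω hω k
  rw [orderedQuery, Finset.sum_congr rfl fun i _ => max_eq_right (hω i),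
    Finset.sum_range_sub (fun k => Q k ω), hQ.origin, sub_zero]

lemma IsPoissonArrivals.orderedQuery {r : ℝ} {Q : ℕ → Ω → ℝ} (hQ : IsPoissonArrivals μ r Q) :
    IsPoissonArrivals μ r (orderedQuery Q) where
  rate_pos := hQ.rate_pos
  measurable k := Finset.measurable_sum _ fun i _ =>
    measurable_const.max ((hQ.measurable (i + 1)).sub (hQ.measurable i))
  origin ω := by simp [PullOrWait.orderedQuery]
  gap_indep := by
    simp only [orderedQuery_gap]
    exact hQ.gap_indep.comp (fun _ x => max 0 x) fun _ => by fun_prop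
  gap_law k := by
    refine (hQ.gap_law k).congr ?_
    filter_upwards [hQ.ae_gap_nonneg k] with ω hω
    rw [orderedQuery_gap, max_eq_right hω]

lemma measurable_clampedDelay {a b : ℝ} {Y : ℕ → Ω → ℝ} (hY : ∀ j, Measurable (Y j)) (j : ℕ) :
    Measurable (clampedDelay a b Y j) :=
  measurable_const.max (measurable_const.min (hY j))

variable [MeasurableSpace 𝓦] [IsProbabilityMeasure μ]

/-- The past is enlarged one block at a time, from earlier delays to queries and then to `W`, each
block being independent of everything before it. -/
lemma indepFun_delay_past {Y Q : ℕ → Ω → ℝ} {W : Ω → 𝓦} (hY : ∀ j, Measurable (Y j))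
    (hQ : ∀ k, Measurable (Q k)) (hW : Measurable W) (hYi : iIndepFun Y μ)
    (hYQ : IndepFun (fun ω j => Y j ω) (fun ω k => Q k ω) μ)
    (hWi : IndepFun W (fun ω => ((fun j => Y j ω : ℕ → ℝ), (fun k => Q k ω : ℕ → ℝ))) μ) (j : ℕ) :
    IndepFun (Y (j + 1)) (fun ω => (((fun i => Y i ω : Finset.range (j + 1) → ℝ),
      (fun k => Q k ω : ℕ → ℝ)), W ω)) μ := by
  have hB : Measurable fun ω => (fun i => Y i ω : Finset.range (j + 1) → ℝ) :=
    measurable_pi_lambda _ fun i => hY i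
  have hC : Measurable fun ω => (fun k => Q k ω : ℕ → ℝ) := measurable_pi_lambda _ hQ
  have h1 : IndepFun (Y (j + 1)) (fun ω => (fun i => Y i ω : Finset.range (j + 1) → ℝ)) μ :=
    (hYi.indepFun_finset {j + 1} (Finset.range (j + 1)) (by simp) hY).comp
      (φ := fun y : ({j + 1} : Finset ℕ) → ℝ => y ⟨j + 1, by simp⟩) (ψ := id) (by fun_prop)
      measurable_id
  have h2 : IndepFun (Y (j + 1)) (fun ω => ((fun i => Y i ω : Finset.range (j + 1) → ℝ),
      (fun k => Q k ω : ℕ → ℝ))) μ :=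
    indepFun_prodMk_of_indepFun (hY _) hB hC h1
      (hYQ.comp (φ := fun y => (y (j + 1), fun i : Finset.range (j + 1) => y i)) (ψ := id)
        (by fun_prop) measurable_id)
  exact indepFun_prodMk_of_indepFun (hY _) (hB.prodMk hC) hW h2
    (hWi.symm.comp (φ := fun p => (p.1 (j + 1), ((fun i : Finset.range (j + 1) => p.1 i), p.2)))
      (ψ := id) (by fun_prop) measurable_id)

lemma indepFun_gap_past {Y Q : ℕ → Ω → ℝ} {W : Ω → 𝓦} (hY : ∀ j, Measurable (Y j))
    (hQ : ∀ k, Measurable (Q k)) (hW : Measurable W)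
    (hgap : iIndepFun (fun k ω => Q (k + 1) ω - Q k ω) μ)
    (hYQ : IndepFun (fun ω j => Y j ω) (fun ω k => Q k ω) μ)
    (hWi : IndepFun W (fun ω => ((fun j => Y j ω : ℕ → ℝ), (fun k => Q k ω : ℕ → ℝ))) μ) (k : ℕ) :
    IndepFun (fun ω => Q (k + 1) ω - Q k ω)
      (fun ω => (((fun i => Q (i + 1) ω - Q i ω : Finset.range k → ℝ),
      (fun j => Y j ω : ℕ → ℝ)), W ω)) μ := by
  have hX : ∀ k, Measurable fun ω => Q (k + 1) ω - Q k ω := fun k => (hQ (k + 1)).sub (hQ k)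
  have hB : Measurable fun ω => (fun i => Q (i + 1) ω - Q i ω : Finset.range k → ℝ) :=
    measurable_pi_lambda _ fun i => hX i
  have hC : Measurable fun ω => (fun j => Y j ω : ℕ → ℝ) := measurable_pi_lambda _ hY
  have h1 : IndepFun (fun ω => Q (k + 1) ω - Q k ω)
      (fun ω => (fun i => Q (i + 1) ω - Q i ω : Finset.range k → ℝ)) μ :=
    (hgap.indepFun_finset {k} (Finset.range k) (by simp) hX).comp
      (φ := fun y : ({k} : Finset ℕ) → ℝ => y ⟨k, by simp⟩) (ψ := id) (by fun_prop)
      measurable_id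
  have h2 : IndepFun (fun ω => Q (k + 1) ω - Q k ω)
      (fun ω => ((fun i => Q (i + 1) ω - Q i ω : Finset.range k → ℝ),
      (fun j => Y j ω : ℕ → ℝ))) μ :=
    indepFun_prodMk_of_indepFun (hX k) hB hC h1
      (hYQ.symm.comp
        (φ := fun q => (q (k + 1) - q k, fun i : Finset.range k => q (i + 1) - q i)) (ψ := id)
        (by fun_prop) measurable_id)
  exact indepFun_prodMk_of_indepFun (hX k) (hB.prodMk hC) hW h2
    (hWi.symm.comp (φ := fun p => (p.2 (k + 1) - p.2 k,
      ((fun i : Finset.range k => p.2 (i + 1) - p.2 i), p.1)))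
      (ψ := id) (by fun_prop) measurable_id)

/-- Run with bounded delays and ordered queries, decision rules form a regular system. -/
lemma regularSystem_runPolicy {Y Q : ℕ → Ω → ℝ} {W : Ω → 𝓦} {ν : Measure ℝ} {r a b M : ℝ}
    (ha : 0 < a) (hM : 0 ≤ M) (hY : ∀ j, Measurable (Y j)) (hYmem : ∀ j ω, Y j ω ∈ Set.Icc a b)
    (hlaw : ∀ j, μ.map (Y j) = ν) (hYi : iIndepFun Y μ) (hQ : IsPoissonArrivals μ r Q)
    (hQmono : ∀ ω, Monotone fun k => Q k ω) (hW : Measurable W)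
    (hYQ : IndepFun (fun ω j => Y j ω) (fun ω k => Q k ω) μ)
    (hWi : IndepFun W (fun ω => ((fun j => Y j ω : ℕ → ℝ), (fun k => Q k ω : ℕ → ℝ))) μ)
    {f : ∀ j : ℕ, 𝓦 × (Fin (j + 1) → ℝ) × (Fin j → ℝ) × (ℕ → ℝ) → ℝ}
    (hf : ∀ j, Measurable (f j)) (hfmem : ∀ j p, f j p ∈ Set.Icc 0 M) :
    RegularSystem μ ν r a b M Y Q (runPolicy f W Y (observe Q)) where
  lower_pos := ha
  wait_bound_nonneg := hM
  delay_measurable := hY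
  wait_measurable j :=
    measurable_runPolicy hf hW (measurable_observe hQ.measurable) j fun i _ => hY i
  delay_mem := hYmem
  wait_mem j ω := by rw [runPolicy_eq]; exact hfmem _ _
  delay_law := hlaw
  poisson := hQ
  query_mono := hQmono
  delay_indep j := by
    set T : Ω → ((Finset.range (j + 1) → ℝ) × (ℕ → ℝ)) × 𝓦 := fun ω =>
      ((fun i => Y i ω, fun k => Q k ω), W ω) with hT
    have hT1 : Measurable fun ω => (fun i => Y i ω : Finset.range (j + 1) → ℝ) :=
      measurable_pi_lambda _ fun i => hY i
    have hTm : Measurable T := (hT1.prodMk (measurable_pi_lambda _ hQ.measurable)).prodMk hW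
    have hTc : Measurable[MeasurableSpace.comap T inferInstance] T := comap_measurable T
    have hYm : ∀ i ≤ j, Measurable[MeasurableSpace.comap T inferInstance] (Y i) := fun i hi =>
      (by fun_prop : Measurable fun p : ((Finset.range (j + 1) → ℝ) × (ℕ → ℝ)) × 𝓦 =>
        p.1.1 ⟨i, Finset.mem_range_succ_iff.mpr hi⟩).comp hTc
    have hQm : ∀ k, Measurable[MeasurableSpace.comap T inferInstance] (Q k) := fun k =>
      (by fun_prop : Measurable fun p : ((Finset.range (j + 1) → ℝ) × (ℕ → ℝ)) × 𝓦 =>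
        p.1.2 k).comp hTc
    have hWm : Measurable[MeasurableSpace.comap T inferInstance] W := measurable_snd.comp hTc
    refine ⟨MeasurableSpace.comap T inferInstance, hTm.comap_le,
      indepFun_delay_past hY hQ.measurable hW hYi hYQ hWi j, hYm, fun i hi => ?_, hQm⟩
    exact measurable_runPolicy hf hWm (measurable_observe hQm) i fun l hl => hYm l (hl.trans hi)
  nonanticipating k := by
    -- `T` contains all the delays, even future ones, but only the gaps before `Q k`; the run with
    -- later queries hidden is measurable with respect to it.
    set T : Ω → ((Finset.range k → ℝ) × (ℕ → ℝ)) × 𝓦 := fun ω =>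
      ((fun i => Q (i + 1) ω - Q i ω, fun j => Y j ω), W ω) with hT
    have hTc : Measurable[MeasurableSpace.comap T inferInstance] T := comap_measurable T
    have hYm : ∀ i, Measurable[MeasurableSpace.comap T inferInstance] (Y i) := fun i =>
      (by fun_prop : Measurable fun p : ((Finset.range k → ℝ) × (ℕ → ℝ)) × 𝓦 =>
        p.1.2 i).comp hTc
    have hgm : ∀ i < k, Measurable[MeasurableSpace.comap T inferInstance]
        (fun ω => Q (i + 1) ω - Q i ω) := fun i hi =>
      (by fun_prop : Measurable fun p : ((Finset.range k → ℝ) × (ℕ → ℝ)) × 𝓦 =>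
        p.1.1 ⟨i, Finset.mem_range.mpr hi⟩).comp hTc
    have hQm : ∀ i ≤ k, Measurable[MeasurableSpace.comap T inferInstance] (Q i) := by
      intro i hi
      have e : Q i = fun ω => ∑ l ∈ Finset.range i, (Q (l + 1) ω - Q l ω) := by
        rw [hQ.eq_sum_gaps i]
        exact funext fun ω => Finset.sum_apply _ _ _
      rw [e]
      exact Finset.measurable_sum _ fun l hl => hgm l ((Finset.mem_range.mp hl).trans_le hi)
    have hWm : Measurable[MeasurableSpace.comap T inferInstance] W := measurable_snd.comp hTc
    refine ⟨runPolicy f W Y (observeUpTo k Q), fun j => measurable_runPolicy hf hW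
      (measurable_observeUpTo fun i _ => hQ.measurable i) j fun i _ => hY i, ?_, ?_⟩
    · have hZm : ∀ j, Measurable[MeasurableSpace.comap T inferInstance]
          (runPolicy f W Y (observeUpTo k Q) j) := fun j =>
        measurable_runPolicy hf hWm (measurable_observeUpTo hQm) j fun i _ => hYm i
      have hH : Measurable[MeasurableSpace.comap T inferInstance]
          (fun ω => ((fun j => Y j ω : ℕ → ℝ),
            (fun j => runPolicy f W Y (observeUpTo k Q) j ω : ℕ → ℝ), Q k ω)) :=
        measurable_prodMk_sequences hYm hZm (hQm k le_rfl)
      exact indep_of_indep_of_le_right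
        (indepFun_gap_past hY hQ.measurable hW hQ.gap_indep hYQ hWi k) hH.comap_le
    · intro ω t _ ht
      exact age_runPolicy_observeUpTo (fun j p => (hfmem j p).1) W
        (fun j => ha.le.trans (hYmem j ω).1) (hQmono ω) ht

/-- A causal policy coincides almost surely with one in a regular system. -/
theorem exists_regularSystem {Y Q : ℕ → Ω → ℝ} {W : Ω → 𝓦} {r a b M : ℝ} (ha : 0 < a) (hM : 0 ≤ M)
    (hY : ∀ j, Measurable (Y j)) (hYi : iIndepFun Y μ)
    (hident : ∀ j, IdentDistrib (Y j) (Y 0) μ μ) (hbdd : ∀ j, ∀ᵐ ω ∂μ, Y j ω ∈ Set.Icc a b)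
    (hQ : IsPoissonArrivals μ r Q) (hW : Measurable W)
    (hYQ : IndepFun (fun ω j => Y j ω) (fun ω k => Q k ω) μ)
    (hWi : IndepFun W (fun ω => ((fun j => Y j ω : ℕ → ℝ), (fun k => Q k ω : ℕ → ℝ))) μ)
    {Z : ℕ → Ω → ℝ} (hZ : Z ∈ causalPolicies W Y Q M) :
    ∃ Y' Q' Z' : ℕ → Ω → ℝ, RegularSystem μ (μ.map (Y 0)) r a b M Y' Q' Z' ∧
      ∀ᵐ ω ∂μ, ∀ j, Y j ω = Y' j ω ∧ Q j ω = Q' j ω ∧ Z j ω = Z' j ω := by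
  have hab : a ≤ b := by
    obtain ⟨ω, hω⟩ := (hbdd 0).exists
    exact hω.1.trans hω.2
  -- Doob–Dynkin: measurability with respect to the history yields decision rules, which can be
  -- applied to altered data.
  have hf : ∀ j, ∃ f : 𝓦 × (Fin (j + 1) → ℝ) × (Fin j → ℝ) × (ℕ → ℝ) → ℝ,
      Measurable f ∧ Z j = f ∘ history W Y Q Z j := fun j => (hZ j).2.exists_eq_measurable_comp
  choose f hfm hfZ using hf
  have hYae : ∀ᵐ ω ∂μ, ∀ j, clampedDelay a b Y j ω = Y j ω := by
    filter_upwards [ae_all_iff.mpr hbdd] with ω hω j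
    exact clampedDelay_eq (hω j)
  have hQae := hQ.ae_orderedQuery_eq
  -- The rules are unconstrained off the range of the history, so they are clamped; on the original
  -- data this changes nothing.
  set f' : ∀ j : ℕ, 𝓦 × (Fin (j + 1) → ℝ) × (Fin j → ℝ) × (ℕ → ℝ) → ℝ :=
    fun j p => max 0 (min M (f j p)) with hf'
  have hseqY : Measurable fun (y : ℕ → ℝ) j => max a (min b (y j)) := by fun_prop
  have hseqQ : Measurable fun (q : ℕ → ℝ) k =>
      ∑ i ∈ Finset.range k, max 0 (q (i + 1) - q i) := by fun_prop
  refine ⟨clampedDelay a b Y, orderedQuery Q,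
    runPolicy f' W (clampedDelay a b Y) (observe (orderedQuery Q)),
    regularSystem_runPolicy ha hM (measurable_clampedDelay hY) (clampedDelay_mem hab Y) ?_ ?_
      hQ.orderedQuery (monotone_orderedQuery Q) hW (hYQ.comp hseqY hseqQ)
      (hWi.comp (φ := id) measurable_id
        ((hseqY.comp measurable_fst).prodMk (hseqQ.comp measurable_snd))) ?_ ?_, ?_⟩
  · intro j
    rw [← (hident j).map_eq]
    exact Measure.map_congr (hYae.mono fun ω hω => hω j)
  · exact hYi.comp (fun _ x => max a (min b x)) fun _ => by fun_prop
  · exact fun j => measurable_const.max (measurable_const.min (hfm j))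
  · exact fun j p => ⟨le_max_left _ _, max_le hM (min_le_left _ _)⟩
  · filter_upwards [hYae, hQae] with ω hYω hQω
    have hZω : ∀ j, Z j ω
        = runPolicy f' W (clampedDelay a b Y) (observe (orderedQuery Q)) j ω := by
      intro j
      induction j using Nat.strong_induction_on with
      | _ j ih =>
        have h1 : Z j ω = f' j (history W Y Q Z j ω) := by
          have hmem := (hZ j).1 ω
          have e : f j (history W Y Q Z j ω) = Z j ω := (congrFun (hfZ j) ω).symm
          simp only [hf', e, min_eq_right hmem.2, max_eq_right hmem.1]
        rw [h1, runPolicy_eq, history,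
          ← delivery_congr (Z := Z) (fun i => (hYω i).symm) ih]
        have e1 : (fun i : Fin (j + 1) => Y i ω) = fun i : Fin (j + 1) => clampedDelay a b Y i ω :=
          funext fun i => (hYω i).symm
        have e2 : (fun i : Fin j => Z i ω) = fun i : Fin j =>
            runPolicy f' W (clampedDelay a b Y) (observe (orderedQuery Q)) i ω :=
          funext fun i => ih i i.2
        have e3 : (fun k => min (Q k ω) (delivery Y Z j ω))
            = observe (orderedQuery Q) ω (delivery Y Z j ω) :=
          funext fun k => by rw [observe, hQω]
        rw [e1, e2, e3]
    exact fun j => ⟨(hYω j).symm, (hQω j).symm, hZω j⟩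

end Regularization

/-! ### Limits of averages and vanishing loss per cycle -/

section Limsup

open Topology

/-- The lower bound gives `liminf u ≥ v`, so `limsup u = v` forces convergence. Boundedness above
keeps the real-valued `limsup` from being a default value. -/
lemma le_limsup_and_limsup_eq_iff {u e : ℕ → ℝ} {v : ℝ} (hu : IsBoundedUnder (· ≤ ·) atTop u)
    (he : Tendsto e atTop (𝓝 0)) (hue : ∀ᶠ n in atTop, v - e n ≤ u n) :
    v ≤ limsup u atTop ∧ (limsup u atTop = v ↔ Tendsto u atTop (𝓝 v)) := by
  have hve : Tendsto (fun n => v - e n) atTop (𝓝 v) := by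
    simpa using (tendsto_const_nhds (x := v)).sub he
  have hb : IsBoundedUnder (· ≥ ·) atTop u := hve.isBoundedUnder_ge.mono_ge hue
  have h1 : v ≤ liminf u atTop := by
    rw [← hve.liminf_eq]
    exact liminf_le_liminf hue hve.isBoundedUnder_ge hu.isCoboundedUnder_ge
  have h2 : liminf u atTop ≤ limsup u atTop := liminf_le_limsup hu hb
  refine ⟨h1.trans h2, fun h => ?_, fun h => h.limsup_eq⟩
  exact tendsto_of_le_liminf_of_limsup_le h1 h.le hu hb

lemma limsup_ratio {L d : ℕ → ℝ} {v a c C : ℝ} (ha : 0 < a) (hL0 : ∀ n, 0 ≤ L n)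
    (hLC : ∀ n, L n ≤ C * n) (hd : ∀ n : ℕ, n * a ≤ d n) (hdc : ∀ n : ℕ, d n ≤ n * c) :
    v ≤ limsup (fun n => (L n + v * d n) / d n) atTop ∧
      (limsup (fun n => (L n + v * d n) / d n) atTop = v
        ↔ Tendsto (fun n : ℕ => L n / n) atTop (𝓝 0)) := by
  have hpos : ∀ n : ℕ, 0 < n → (0 : ℝ) < n ∧ 0 < d n := fun n hn => by
    have hn' : (0 : ℝ) < n := by exact_mod_cast hn
    exact ⟨hn', (mul_pos hn' ha).trans_le (hd n)⟩
  have hu : ∀ n : ℕ, 0 < n → (L n + v * d n) / d n = v + L n / d n := fun n hn => by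
    have := (hpos n hn).2.ne'
    field_simp
    ring
  have hle : ∀ n : ℕ, 0 < n → L n / d n ≤ L n / n / a := fun n hn => by
    rw [div_div]
    exact div_le_div_of_nonneg_left (hL0 n) (mul_pos (hpos n hn).1 ha) (hd n)
  have hbdd : IsBoundedUnder (· ≤ ·) atTop fun n => (L n + v * d n) / d n := by
    refine isBoundedUnder_of_eventually_le (a := v + C / a) ?_
    filter_upwards [eventually_gt_atTop 0] with n hn
    rw [hu n hn]
    refine add_le_add_right ((hle n hn).trans (div_le_div_of_nonneg_right ?_ ha.le)) v
    rw [div_le_iff₀ (hpos n hn).1]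
    exact hLC n
  obtain ⟨h1, h2⟩ := le_limsup_and_limsup_eq_iff (v := v) hbdd tendsto_const_nhds (by
    filter_upwards [eventually_gt_atTop 0] with n hn
    rw [hu n hn, sub_zero]
    exact le_add_of_nonneg_right (div_nonneg (hL0 n) (hpos n hn).2.le))
  refine ⟨h1, h2.trans ⟨fun h => ?_, fun h => ?_⟩⟩
  · have h3 : Tendsto (fun n => ((L n + v * d n) / d n - v) * c) atTop (𝓝 0) := by
      simpa using (h.sub_const v).mul_const c
    refine squeeze_zero' (Eventually.of_forall fun n => div_nonneg (hL0 n) n.cast_nonneg) ?_ h3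
    filter_upwards [eventually_gt_atTop 0] with n hn
    obtain ⟨hn', hdn⟩ := hpos n hn
    rw [hu n hn, add_sub_cancel_left, div_mul_eq_mul_div, div_le_div_iff₀ hn' hdn]
    nlinarith [mul_le_mul_of_nonneg_left (hdc n) (hL0 n)]
  · have h3 : Tendsto (fun n : ℕ => v + L n / n / a) atTop (𝓝 v) := by
      simpa using (h.div_const a).const_add v
    refine tendsto_of_tendsto_of_tendsto_of_le_of_le' tendsto_const_nhds h3 ?_ ?_
    · filter_upwards [eventually_gt_atTop 0] with n hn
      rw [hu n hn]
      exact le_add_of_nonneg_right (div_nonneg (hL0 n) (hpos n hn).2.le)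
    · filter_upwards [eventually_gt_atTop 0] with n hn
      rw [hu n hn]
      exact add_le_add_right (hle n hn) v

/-- `S` and `L` control each other after linear changes of index, and `L n / n → 0` is insensitive
to such changes; the constant `C` disappears on division by `n`. -/
lemma limsup_average {L S : ℕ → ℝ} {v r B C : ℝ} {p q : ℕ} (hr : 0 < r) (hp : 0 < p) (hq : 0 < q)
    (hL0 : ∀ n, 0 ≤ L n) (hLB : ∀ n, L n ≤ B * n) (hSle : ∀ n, 0 < n → S n ≤ L (p * n) + C)
    (hleS : ∀ k, 0 < k → L k - C ≤ S (q * k)) (hSC : ∀ n, 0 < n → -C ≤ S n) :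
    v ≤ limsup (fun n : ℕ => (r * S n + v * n) / n) atTop ∧
      (limsup (fun n : ℕ => (r * S n + v * n) / n) atTop = v
        ↔ Tendsto (fun n : ℕ => L n / n) atTop (𝓝 0)) := by
  have hu : ∀ n : ℕ, 0 < n → (r * S n + v * n) / n = v + r * (S n / n) := fun n hn => by
    have : (n : ℝ) ≠ 0 := by exact_mod_cast hn.ne'
    field_simp
    ring
  have hC0 : Tendsto (fun n : ℕ => C / n) atTop (𝓝 0) := tendsto_const_div_atTop_nhds_zero_nat C
  have hup : ∀ n : ℕ, 0 < n → S n / n ≤ p * (L (p * n) / ((p * n : ℕ) : ℝ)) + C / n :=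
    fun n hn => by
      have hn' : (0 : ℝ) < n := by exact_mod_cast hn
      have hp' : (0 : ℝ) < p := by exact_mod_cast hp
      have e : p * (L (p * n) / ((p * n : ℕ) : ℝ)) + C / n = (L (p * n) + C) / n := by
        push_cast
        field_simp
      rw [e]
      exact div_le_div_of_nonneg_right (hSle n hn) hn'.le
  have hlow : ∀ n : ℕ, 0 < n → -(C / n) ≤ S n / n := fun n hn => by
    rw [← neg_div]
    exact div_le_div_of_nonneg_right (hSC n hn) n.cast_nonneg
  have hbdd : IsBoundedUnder (· ≤ ·) atTop fun n : ℕ => (r * S n + v * n) / n := by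
    have h3 : Tendsto (fun n : ℕ => v + r * (p * B + C / n)) atTop (𝓝 (v + r * (p * B + 0))) :=
      ((hC0.const_add _).const_mul r).const_add v
    refine h3.isBoundedUnder_le.mono_le ?_
    filter_upwards [eventually_gt_atTop 0] with n hn
    rw [hu n hn]
    refine add_le_add_right (mul_le_mul_of_nonneg_left ((hup n hn).trans (add_le_add_left
      (mul_le_mul_of_nonneg_left ?_ p.cast_nonneg) _)) hr.le) v
    rw [div_le_iff₀ (by exact_mod_cast Nat.mul_pos hp hn)]
    exact hLB _
  have hlow' : ∀ᶠ n : ℕ in atTop, v - r * (C / n) ≤ (r * S n + v * n) / n := by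
    filter_upwards [eventually_gt_atTop 0] with n hn
    rw [hu n hn]
    nlinarith [mul_le_mul_of_nonneg_left (hlow n hn) hr.le]
  have he : Tendsto (fun n : ℕ => r * (C / n)) atTop (𝓝 0) := by simpa using hC0.const_mul r
  obtain ⟨h1, h2⟩ := le_limsup_and_limsup_eq_iff hbdd he hlow'
  refine ⟨h1, h2.trans ⟨fun h => ?_, fun h => ?_⟩⟩
  · have hS : Tendsto (fun n : ℕ => S n / n) atTop (𝓝 0) := by
      have h3 : Tendsto (fun n : ℕ => ((r * S n + v * n) / n - v) / r) atTop (𝓝 0) := by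
        simpa using (h.sub_const v).div_const r
      refine h3.congr' ?_
      filter_upwards [eventually_gt_atTop 0] with n hn
      rw [hu n hn]
      field_simp
      ring
    have h3 : Tendsto (fun k : ℕ => q * (S (q * k) / ((q * k : ℕ) : ℝ)) + C / k) atTop (𝓝 0) := by
      have := ((hS.comp (tendsto_id.const_mul_atTop' hq)).const_mul (q : ℝ)).add hC0
      simpa using this
    refine squeeze_zero' (Eventually.of_forall fun n => div_nonneg (hL0 n) n.cast_nonneg) ?_ h3
    filter_upwards [eventually_gt_atTop 0] with k hk
    have hk' : (0 : ℝ) < k := by exact_mod_cast hk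
    have hq' : (0 : ℝ) < q := by exact_mod_cast hq
    have e : q * (S (q * k) / ((q * k : ℕ) : ℝ)) + C / k = (S (q * k) + C) / k := by
      push_cast
      field_simp
    rw [e]
    exact div_le_div_of_nonneg_right (by linarith [hleS k hk]) hk'.le
  · have h3 : Tendsto (fun n : ℕ => v + r * (p * (L (p * n) / ((p * n : ℕ) : ℝ)) + C / n)) atTop
        (𝓝 v) := by
      have := ((((h.comp (tendsto_id.const_mul_atTop' hp)).const_mul (p : ℝ)).add hC0).const_mul
        r).const_add v
      simpa using this
    refine tendsto_of_tendsto_of_tendsto_of_le_of_le' (g := fun n : ℕ => v - r * (C / n))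
      (by simpa using he.const_sub v) h3 hlow' ?_
    filter_upwards [eventually_gt_atTop 0] with n hn
    rw [hu n hn]
    exact add_le_add_right (mul_le_mul_of_nonneg_left (hup n hn) hr.le) v

end Limsup

/-! ### The common optimality criterion for the two objectives -/

namespace RegularSystem

open Topology

variable {Ω : Type*} [mΩ : MeasurableSpace Ω] {μ : Measure Ω} [IsProbabilityMeasure μ]
  {ν : Measure ℝ} {r a b M v x : ℝ} {Y Q Z : ℕ → Ω → ℝ} {g : ℝ → ℝ}

theorem timeAveragePenalty_spec (h : RegularSystem μ ν r a b M Y Q Z) (hg : Continuous g)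
    (hmono : Monotone g) (ho : IsOptimalThreshold ν g a b M v x) :
    v ≤ timeAveragePenalty μ g Y Z ∧ (timeAveragePenalty μ g Y Z = v ↔
      Tendsto (fun n : ℕ => cumulativeLoss μ ν g v M x Y Z n / n) atTop (𝓝 0)) := by
  obtain ⟨C, -, hC⟩ := h.exists_cumulativeLoss_le hg hmono v x
  have key := limsup_ratio (v := v) (d := fun n => ∫ ω, delivery Y Z n ω ∂μ) (c := M + b)
    h.lower_pos (h.cumulativeLoss_nonneg ho) hC
    (fun n => by
      have := integral_mono (μ := μ) (integrable_const (n * a)) (h.integrable_delivery n)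
        fun ω => mul_le_delivery (h.delay_mem · ω) (h.wait_mem · ω) n
      simpa using this)
    (fun n => by
      have := integral_mono (μ := μ) (h.integrable_delivery n) (integrable_const (n * (M + b)))
        fun ω => delivery_le_mul (h.delay_mem · ω) (h.wait_mem · ω) n
      simpa using this)
  simpa only [timeAveragePenalty, h.integral_delivery_eq hg hmono ho] using key

theorem queryAveragePenalty_spec (h : RegularSystem μ ν r a b M Y Q Z) (hg : Continuous g)
    (hmono : Monotone g) (hg0 : ∀ y, 0 ≤ g y) (ho : IsOptimalThreshold ν g a b M v x) :
    v ≤ queryAveragePenalty μ g Y Q Z ∧ (queryAveragePenalty μ g Y Q Z = v ↔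
      Tendsto (fun n : ℕ => cumulativeLoss μ ν g v M x Y Z n / n) atTop (𝓝 0)) := by
  obtain ⟨B, -, hB⟩ := h.exists_cumulativeLoss_le hg hmono v x
  obtain ⟨C, hC1, hC2⟩ := h.exists_bounds_integral_query hg hmono ho
  have hr := h.poisson.rate_pos
  have ha := h.lower_pos
  -- `p * n` cycles last at least twice the mean of `Q n`, while `k` cycles last at most half the
  -- mean of `Q (q * k)`.
  obtain ⟨p, hp⟩ := exists_nat_gt (2 / (r * a))
  obtain ⟨q, hq⟩ := exists_nat_gt (max 0 (2 * r * (M + b)))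
  have hp0 : 0 < p := by
    have : (0 : ℝ) < p := (by positivity : 0 < 2 / (r * a)).trans hp
    exact_mod_cast this
  have hq0 : 0 < q := by
    have : (0 : ℝ) < q := (le_max_left _ _).trans_lt hq
    exact_mod_cast this
  have key := limsup_average (v := v)
    (S := fun n => ∫ ω, (∫ t in (0 : ℝ)..Q n ω, (g (age Y Z ω t) - v)) ∂μ) (C := C) hr hp0 hq0
    (h.cumulativeLoss_nonneg ho) hB
    (fun n hn => hC1 n (p * n) hn (by
      rw [div_lt_iff₀ (by positivity)] at hp
      have hn' : (0 : ℝ) < n := by exact_mod_cast hn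
      push_cast
      rw [← mul_div_assoc, div_le_iff₀ hr]
      nlinarith))
    (fun k hk => hC2 (q * k) k (Nat.mul_pos hq0 hk) (by
      have hq' : 2 * r * (M + b) ≤ q := (le_max_right _ _).trans hq.le
      have hk' : (0 : ℝ) < k := by exact_mod_cast hk
      push_cast
      rw [div_div, le_div_iff₀ (by positivity)]
      nlinarith))
    (fun n hn => by
      -- With zero cycles the loss is zero, which leaves the constant lower bound.
      have := hC2 n 0 hn (by simp; positivity)
      simpa [cumulativeLoss] using this)
  -- Since `E[Q n] = n / r`, the price contributes `r * v * (n / r) = v * n`.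
  have e : ∀ n : ℕ, ∫ ω, (∑ k ∈ Finset.Icc 1 n, g (age Y Z ω (Q k ω))) ∂μ
      = r * (∫ ω, (∫ t in (0 : ℝ)..Q n ω, (g (age Y Z ω t) - v)) ∂μ) + v * n := fun n => by
    rw [h.integral_sum_age_query hg hg0, h.integral_sub_const hg v (h.poisson.measurable n)
      (h.query_nonneg n) (h.poisson.integrable n), h.poisson.integral_eq]
    field_simp
  simpa only [queryAveragePenalty, e] using key

end RegularSystem

/-! ### Transfer to the original data and conclusion -/

section Transfer

variable {Ω 𝓦 : Type*} {r a b M : ℝ} {Y Q Z Y' Q' Z' : ℕ → Ω → ℝ}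

lemma age_congr {ω : Ω} (hY : ∀ j, Y j ω = Y' j ω) (hZ : ∀ j, Z j ω = Z' j ω) (t : ℝ) :
    age Y Z ω t = age Y' Z' ω t := by
  simp only [age, request, delivery_congr hY (fun i _ => hZ i), hY]

lemma thresholdPolicy_mem_causalPolicies [MeasurableSpace 𝓦] (W : Ω → 𝓦) (Y Q : ℕ → Ω → ℝ)
    (hM : 0 ≤ M) (x : ℝ) :
    (fun j ω => thresholdWait M x (Y j ω)) ∈ causalPolicies W Y Q M := by
  refine fun j => ⟨fun ω => thresholdWait_mem hM x _, ?_⟩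
  have h1 : Measurable fun p : 𝓦 × (Fin (j + 1) → ℝ) × (Fin j → ℝ) × (ℕ → ℝ) =>
      thresholdWait M x (p.2.1 (Fin.last j)) :=
    ((continuous_thresholdWait M).comp (continuous_const.prodMk continuous_id)).measurable.comp
      (by fun_prop)
  exact h1.comp (comap_measurable _)

variable [MeasurableSpace Ω] {μ : Measure Ω} {ν : Measure ℝ} {g g' : ℝ → ℝ}

lemma timeAveragePenalty_congr (h : RegularSystem μ ν r a b M Y' Q' Z')
    (hae : ∀ᵐ ω ∂μ, ∀ j, Y j ω = Y' j ω ∧ Q j ω = Q' j ω ∧ Z j ω = Z' j ω)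
    (hg : ∀ y, 0 ≤ y → g y = g' y) :
    timeAveragePenalty μ g Y Z = timeAveragePenalty μ g' Y' Z' := by
  unfold timeAveragePenalty
  congr 1
  ext n
  congr 1
  · refine integral_congr_ae ?_
    filter_upwards [hae] with ω hω
    rw [delivery_congr (fun j => (hω j).1) fun j _ => (hω j).2.2]
    refine intervalIntegral.integral_congr fun t ht => ?_
    rw [Set.uIcc_of_le (h.delivery_nonneg n ω)] at ht
    rw [age_congr (fun j => (hω j).1) fun j => (hω j).2.2]
    exact hg _ (age_mem h.lower_pos (h.delay_mem · ω) (h.wait_mem · ω) ht.1).1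
  · refine integral_congr_ae ?_
    filter_upwards [hae] with ω hω
    exact delivery_congr (fun j => (hω j).1) fun j _ => (hω j).2.2

lemma queryAveragePenalty_congr (h : RegularSystem μ ν r a b M Y' Q' Z')
    (hae : ∀ᵐ ω ∂μ, ∀ j, Y j ω = Y' j ω ∧ Q j ω = Q' j ω ∧ Z j ω = Z' j ω)
    (hg : ∀ y, 0 ≤ y → g y = g' y) :
    queryAveragePenalty μ g Y Q Z = queryAveragePenalty μ g' Y' Q' Z' := by
  unfold queryAveragePenalty
  congr 1
  ext n
  congr 1
  refine integral_congr_ae ?_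
  filter_upwards [hae] with ω hω
  refine Finset.sum_congr rfl fun k _ => ?_
  rw [(hω k).2.1, age_congr (fun j => (hω j).1) fun j => (hω j).2.2]
  exact hg _ (age_mem h.lower_pos (h.delay_mem · ω) (h.wait_mem · ω) (h.query_nonneg k ω)).1

lemma cumulativeLoss_thresholdPolicy (g : ℝ → ℝ) {v x : ℝ}
    (hZ : ∀ᵐ ω ∂μ, ∀ j, Z j ω = thresholdWait M x (Y j ω)) (n : ℕ) :
    cumulativeLoss μ ν g v M x Y Z n = 0 := by
  refine Finset.sum_eq_zero fun j _ => integral_eq_zero_of_ae ?_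
  filter_upwards [hZ] with ω hω
  simp [cycleLoss, hω j]

end Transfer

end PullOrWait

theorem proposition1 {Ω 𝓦 : Type*} [MeasurableSpace Ω] [MeasurableSpace 𝓦]
    (μ : Measure Ω) [IsProbabilityMeasure μ]
    (Y Q : ℕ → Ω → ℝ) (W : Ω → 𝓦) (g : ℝ → ℝ) (M B_L B_U r : ℝ)
    (hM : 0 ≤ M) (hB : 0 < B_L)
    -- the age penalty function on `[0, ∞)`
    (hg_cont : ContinuousOn g (Set.Ici 0)) (hg_mono : MonotoneOn g (Set.Ici 0))
    (hg_nonneg : ∀ x, 0 ≤ x → 0 ≤ g x)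
    -- the i.i.d. bounded transmission delays
    (hY_meas : ∀ j, Measurable (Y j)) (hY_indep : iIndepFun Y μ)
    (hY_ident : ∀ j, IdentDistrib (Y j) (Y 0) μ μ)
    (hY_bdd : ∀ j, ∀ᵐ ω ∂μ, Y j ω ∈ Set.Icc B_L B_U)
    -- the Poisson queries
    (hQ : PullOrWait.IsPoissonArrivals μ r Q)
    -- the randomization device, the delays and the queries are independent of each other
    (hW_meas : Measurable W)
    (hYQ : IndepFun (fun ω j => Y j ω) (fun ω k => Q k ω) μ)
    (hW_indep : IndepFun W (fun ω => ((fun j => Y j ω : ℕ → ℝ), (fun k => Q k ω : ℕ → ℝ))) μ) :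
    (∀ Z ∈ PullOrWait.causalPolicies W Y Q M,
      IsMinOn (PullOrWait.timeAveragePenalty μ g Y) (PullOrWait.causalPolicies W Y Q M) Z ↔
        IsMinOn (PullOrWait.queryAveragePenalty μ g Y Q)
          (PullOrWait.causalPolicies W Y Q M) Z) ∧
    ∃ v : ℝ,
      IsLeast (PullOrWait.timeAveragePenalty μ g Y '' PullOrWait.causalPolicies W Y Q M) v ∧
      IsLeast (PullOrWait.queryAveragePenalty μ g Y Q '' PullOrWait.causalPolicies W Y Q M) v := by
  open PullOrWait in
  -- Extending `g` by the constant `g 0` to the negative axis makes it continuous and monotone on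
  -- the whole line; ages are almost surely nonnegative at the relevant times, so the objectives do
  -- not change.
  have hg'_cont : Continuous fun y => g (max y 0) :=
    hg_cont.comp_continuous (by fun_prop) fun y => le_max_right y 0
  have hg'_mono : Monotone fun y => g (max y 0) := fun y y' hyy =>
    hg_mono (le_max_right y 0) (le_max_right y' 0) (max_le_max_right 0 hyy)
  have hg'_nonneg : ∀ y, 0 ≤ g (max y 0) := fun y => hg_nonneg _ (le_max_right y 0)
  have hgg' : ∀ y, 0 ≤ y → g y = g (max y 0) := fun y hy => by rw [max_eq_left hy]
  have := Measure.isProbabilityMeasure_map (μ := μ) (hY_meas 0).aemeasurable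
  have hν : ∀ᵐ y ∂μ.map (Y 0), y ∈ Set.Icc B_L B_U :=
    (ae_map_iff (hY_meas 0).aemeasurable measurableSet_Icc).mpr (hY_bdd 0)
  obtain ⟨v, x, hopt, hzero⟩ := exists_optimal_threshold hB hM hν hg'_cont hg'_mono
  have ho : IsOptimalThreshold (μ.map (Y 0)) (fun y => g (max y 0)) B_L B_U M v x :=
    ⟨hopt, hzero⟩
  have spec : ∀ Z ∈ causalPolicies W Y Q M,
      v ≤ timeAveragePenalty μ g Y Z ∧ v ≤ queryAveragePenalty μ g Y Q Z ∧
        (timeAveragePenalty μ g Y Z = v ↔ queryAveragePenalty μ g Y Q Z = v) := by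
    intro Z hZ
    obtain ⟨Y', Q', Z', h, hae⟩ := exists_regularSystem hB hM hY_meas hY_indep hY_ident hY_bdd hQ
      hW_meas hYQ hW_indep hZ
    rw [timeAveragePenalty_congr h hae hgg', queryAveragePenalty_congr h hae hgg']
    have ht := h.timeAveragePenalty_spec hg'_cont hg'_mono ho
    have hq := h.queryAveragePenalty_spec hg'_cont hg'_mono hg'_nonneg ho
    exact ⟨ht.1, hq.1, ht.2.trans hq.2.symm⟩
  set Z₀ : ℕ → Ω → ℝ := fun j ω => thresholdWait M x (Y j ω) with hZ₀
  have hZ₀mem : Z₀ ∈ causalPolicies W Y Q M := thresholdPolicy_mem_causalPolicies W Y Q hM x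
  have htime : timeAveragePenalty μ g Y Z₀ = v := by
    obtain ⟨Y', Q', Z', h, hae⟩ := exists_regularSystem hB hM hY_meas hY_indep hY_ident hY_bdd hQ
      hW_meas hYQ hW_indep hZ₀mem
    rw [timeAveragePenalty_congr h hae hgg',
      (h.timeAveragePenalty_spec hg'_cont hg'_mono ho).2]
    have hloss := cumulativeLoss_thresholdPolicy (μ := μ) (ν := μ.map (Y 0)) (Y := Y') (Z := Z')
      (M := M) (fun y => g (max y 0)) (v := v) (x := x) (by
        filter_upwards [hae] with ω hω j
        rw [← (hω j).2.2, ← (hω j).1])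
    simp [hloss]
  have hquery : queryAveragePenalty μ g Y Q Z₀ = v := (spec Z₀ hZ₀mem).2.2.mp htime
  refine ⟨fun Z hZ => ?_, v, ⟨⟨Z₀, hZ₀mem, htime⟩, ?_⟩, ⟨⟨Z₀, hZ₀mem, hquery⟩, ?_⟩⟩
  · obtain ⟨h1, h2, h3⟩ := spec Z hZ
    -- As `Z₀` attains the lower bound `v`, being a minimizer means having value `v`; for both
    -- objectives this is the vanishing of the loss per cycle.
    have ht : IsMinOn (timeAveragePenalty μ g Y) (causalPolicies W Y Q M) Z
        ↔ timeAveragePenalty μ g Y Z = v :=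
      ⟨fun h => le_antisymm (htime ▸ isMinOn_iff.mp h Z₀ hZ₀mem) h1,
        fun h => isMinOn_iff.mpr fun Z' hZ' => h ▸ (spec Z' hZ').1⟩
    have hq : IsMinOn (queryAveragePenalty μ g Y Q) (causalPolicies W Y Q M) Z
        ↔ queryAveragePenalty μ g Y Q Z = v :=
      ⟨fun h => le_antisymm (hquery ▸ isMinOn_iff.mp h Z₀ hZ₀mem) h2,
        fun h => isMinOn_iff.mpr fun Z' hZ' => h ▸ (spec Z' hZ').2.1⟩
    exact ht.trans (h3.trans hq.symm)
  · rintro _ ⟨Z, hZ, rfl⟩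
    exact (spec Z hZ).1
  · rintro _ ⟨Z, hZ, rfl⟩
    exact (spec Z hZ).2.1
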